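/- Let $(A,\mathfrak m)$ be a one-dimensional noetherian local ring, $J=H^0_{\mathfrak m}(A)$, let $M$ be a one-dimensional finitely generated $A$-module and $N=H^0_{\mathfrak m}(M)$. Here $H^0_{\mathfrak m}(M)=\{x\in M\mid \mathfrak m^k x=0 \text{ for some } k\}$. Then $$\mathrm{grt}(A)\le \mathrm{brt}(A/J)+\mathrm{length}(J)\quad\text{and}\quad \mathrm{grt}(M)\le \mathrm{brt}(A/J)+\mathrm{length}(N).$$ If moreover $A$ and $M$ are Cohen–Macaulay, then $\mathrm{grt}(M)\le \mathrm{brt}(A)$. The notation is as follows. For an ideal $I$ of $A$ and an $A$-module $M$, let $\gamma:\mathbf S(I)\otimes_A M\to \bigoplus_{k\ge 0} I^kM\,t^k\subseteq M[t]$ be the canonical graded surjection from the symmetric algebra of $I$ tensored with $M$ onto the Rees module, and put $E(I;M)_k=\ker\gamma_k/\bigl(\mathbf S_1(I)\cdot\ker\gamma_{k-1}\bigr)$ for $k\ge 1$. The relation type $\mathrm{rt}(I;M)\in\{1,2,\dots,\infty\}$ is the least integer $r\ge 1$ such that $E(I;M)_k=0$ for all $k\ge r+1$. The global relation type is $\mathrm{grt}(M)=\sup\{\mathrm{rt}(I;M)\mid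 I \text{ an ideal of } A\}$, and $\mathrm{grt}(A)$ is the case $M=A$. For a one-dimensional noetherian local ring $R$ let $\mathfrak q_1,\dots,\mathfrak q_s$ be the minimal primary components of $(0)$, that is, the components belonging to the minimal primes of $R$ in a minimal primary decomposition of $(0)$, and let $\mathfrak p_i=\sqrt{\mathfrak q_i}$. Let $n\ge 1$ be least with $\mathfrak n(R)^{n}=0$, where $\mathfrak n(R)$ is the nilradical of $R$, and let $n_i\ge 1$ be least with $\mathfrak p_i^{n_i}\subseteq \mathfrak q_i$. For $l\ge 1$ and $1\le i_1<\dots<i_l\le s$ put $t_{i_1,\dots,i_l}=\max\{n_i\mid i\ne i_1,\dots,i_l\}$, with $\max\emptyset=0$. Then $$\mathrm{brt}(R)=\max\bigl(\{n\}\cup\{e(R/(\mathfrak q_{i_1}\cap\dots\cap\mathfrak q_{i_l}))+t_{i_1,\dots,i_l}\mid l\ge 1,\ 1\le i_1<\dots<i_l\le s\}\bigr),$$ where $e$ denotes the multiplicity of a local ring: if $B$ is a noetherian local ring of dimension $d$ with maximal ideal $\mathfrak m_B$, then $e(B)=\lim_{k\to\infty} d!\,\mathrm{length}(B/\mathfrak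 m_B^{k})/k^{d}$. -/

import Mathlib

open IsLocalRing
open scoped TensorProduct Polynomial

noncomputable section

namespace RelationType

section relations

variable {A : Type*} [CommRing A] (I : Ideal A) (M : Type*) [AddCommGroup M] [Module A M]

/-- The canonical morphism of graded `A`-algebras `α : S(I) → R(I) = ⨁ Iⁿ tⁿ ⊆ A[t]` from the
symmetric algebra of `I` onto the Rees algebra of `I`, sending `x ∈ I = S₁(I)` to `x t`. -/
def symToRees : SymmetricAlgebra A I →ₐ[A] A[X] :=
  SymmetricAlgebra.lift ((Polynomial.monomial 1 : A →ₗ[A] A[X]) ∘ₗ I.subtype)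

/-- The canonical morphism `γ : S(I) ⊗ M → R(I; M) = ⨁ (Iⁿ M) tⁿ ⊆ M[t]`, `s ⊗ m ↦ α(s) m`, onto
the Rees module of `I` with respect to `M`. -/
def symTensorToRees : (SymmetricAlgebra A I) ⊗[A] M →ₗ[A] PolynomialModule A M :=
  TensorProduct.lift <| LinearMap.mk₂ A
    (fun s m => symToRees I s • PolynomialModule.single A 0 m)
    (fun s t m => by rw [map_add, add_smul])
    (fun a s m => by rw [map_smul, smul_assoc])
    (fun s m m' => by rw [PolynomialModule.single_add, smul_add])
    (fun a s m => by rw [PolynomialModule.single_smul, smul_comm])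

/-- The degree `n` component `Sₙ(I)` of the symmetric algebra `S(I)`. -/
def symDegree (n : ℕ) : Submodule A (SymmetricAlgebra A I) :=
  LinearMap.range (SymmetricAlgebra.ι A I) ^ n

/-- The degree `n` component `Sₙ(I) ⊗ M` of `S(I) ⊗ M`. -/
def symTensorDegree (n : ℕ) : Submodule A ((SymmetricAlgebra A I) ⊗[A] M) :=
  LinearMap.range (LinearMap.rTensor M (symDegree I n).subtype)

/-- `ker γₙ`, the `n`-relations of `I` with respect to `M`. -/
def relations (n : ℕ) : Submodule A ((SymmetricAlgebra A I) ⊗[A] M) :=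
  LinearMap.ker (symTensorToRees I M) ⊓ symTensorDegree I M n

/-- `S₁(I) · ker γₙ`, a submodule of `ker γₙ₊₁`. -/
def decomposableRelations (n : ℕ) : Submodule A ((SymmetricAlgebra A I) ⊗[A] M) :=
  Submodule.span A {z | ∃ x : I, ∃ k ∈ relations I M n, z = SymmetricAlgebra.ι A I x • k}

/-- The module of effective `(n+1)`-relations `E(I; M)ₙ₊₁ = ker γₙ₊₁ / S₁(I) · ker γₙ`, as a
submodule of `(S(I) ⊗ M) / S₁(I) · ker γₙ`. -/
def effectiveRelations (n : ℕ) :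
    Submodule A ((SymmetricAlgebra A I ⊗[A] M) ⧸ decomposableRelations I M n) :=
  (relations I M (n + 1)).map (decomposableRelations I M n).mkQ

/-- The relation type `rt(I; M)`: the least integer `r ≥ 1` such that `E(I; M)ₙ₊₁ = 0` for all
`n ≥ r` (and `⊤` if there is none). -/
def rt : ℕ∞ :=
  ⨅ (r : ℕ) (_ : 1 ≤ r ∧ ∀ n : ℕ, r ≤ n → effectiveRelations I M n = ⊥), (r : ℕ∞)

end relations

/-- The global relation type `grt(M) = sup {rt(I; M) | I an ideal of A}`. -/
def grt (A : Type*) [CommRing A] (M : Type*) [AddCommGroup M] [Module A M] : ℕ∞ :=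
  ⨆ I : Ideal A, rt I M

/-- `H⁰_𝔞(M) = {x ∈ M | 𝔞ⁿ x = 0 for some n}`. -/
def H0 {A : Type*} [CommRing A] (𝔞 : Ideal A) (M : Type*) [AddCommGroup M] [Module A M] :
    Submodule A M where
  carrier := {x | ∃ n : ℕ, ∀ a ∈ 𝔞 ^ n, a • x = 0}
  zero_mem' := ⟨0, fun a _ => smul_zero a⟩
  add_mem' := by
    rintro x y ⟨n, hn⟩ ⟨k, hk⟩
    refine ⟨max n k, fun a ha => ?_⟩
    rw [smul_add, hn a (Ideal.pow_le_pow_right (le_max_left n k) ha),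
      hk a (Ideal.pow_le_pow_right (le_max_right n k) ha), add_zero]
  smul_mem' := by
    rintro c x ⟨n, hn⟩
    exact ⟨n, fun a ha => by rw [smul_comm, hn a ha, smul_zero]⟩

/-- A nonzero finitely generated module `M` over a noetherian local ring `A` is Cohen-Macaulay if
`depth M = dim M`, that is, if there is an `M`-regular sequence in the maximal ideal of `A` whose
length is the dimension of `M`. -/
def IsCohenMacaulay (A : Type*) [CommRing A] [IsLocalRing A]
    (M : Type*) [AddCommGroup M] [Module A M] : Prop :=
  ∃ rs : List A, (∀ r ∈ rs, r ∈ maximalIdeal A) ∧ RingTheory.Sequence.IsRegular M rs ∧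
    (rs.length : WithBot ℕ∞) = Module.supportDim A M

/-- The multiplicity of a noetherian local ring `R` with maximal ideal `𝔪` and dimension `d`: the
natural number `e` with `d! · length (R / 𝔪ⁿ) / nᵈ → e` as `n → ∞`. -/
def mult (R : Type*) [CommRing R] (𝔪 : Ideal R) : ℕ :=
  let d : ℕ := ((ringKrullDim R).unbotD 0).toNat
  sInf {e : ℕ | Filter.Tendsto
    (fun n : ℕ => (d.factorial : ℝ) * ((Module.length R (R ⧸ 𝔪 ^ n)).toNat : ℝ) / (n : ℝ) ^ d)
    Filter.atTop (nhds (e : ℝ))}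

/-- The set `{𝔮₁, …, 𝔮ₛ}` of minimal primary components of `(0)`: the members, belonging to minimal
primes of `R`, of a minimal primary decomposition of `(0)`. -/
def minimalComponents (R : Type*) [CommRing R] : Set (Ideal R) :=
  {q | ∃ t : Finset (Ideal R), Submodule.IsMinimalPrimaryDecomposition (⊥ : Ideal R) t ∧
    q ∈ t ∧ q.radical ∈ minimalPrimes R}

/-- The least `n ≥ 1` with `𝔫(R)ⁿ = 0`, where `𝔫(R)` is the nilradical. -/
def nilIndex (R : Type*) [CommRing R] : ℕ :=
  sInf {n : ℕ | 1 ≤ n ∧ nilradical R ^ n = ⊥}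

/-- The least `n ≥ 1` with `r(q)ⁿ ⊆ q`, where `r(q)` is the radical of `q`. -/
def componentIndex {R : Type*} [CommRing R] (q : Ideal R) : ℕ :=
  sInf {n : ℕ | 1 ≤ n ∧ q.radical ^ n ≤ q}

/-- `t_{i₁,…,iₗ} = max {nᵢ | i ≠ i₁, …, iₗ}` for `S = {𝔮_{i₁}, …, 𝔮_{iₗ}}`; it is `0` when `S`
consists of all the minimal primary components. -/
def complIndex {R : Type*} [CommRing R] (S : Set (Ideal R)) : ℕ∞ :=
  ⨆ q ∈ minimalComponents R \ S, (componentIndex q : ℕ∞)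

/-- The bound `brt(R)` of a noetherian local ring `R` with maximal ideal `𝔪`: the maximum of
`nilIndex R` and of the numbers `e(R / (𝔮_{i₁} ∩ … ∩ 𝔮_{iₗ})) + t_{i₁,…,iₗ}`, for all
`1 ≤ i₁ < … < iₗ ≤ s`, `l ≥ 1`. -/
def brt (R : Type*) [CommRing R] (𝔪 : Ideal R) : ℕ∞ :=
  max (nilIndex R : ℕ∞)
    (⨆ S : {S : Set (Ideal R) // S ⊆ minimalComponents R ∧ S.Nonempty},
      (mult (R ⧸ sInf S.1) (𝔪.map (Ideal.Quotient.mk (sInf S.1))) : ℕ∞) + complIndex S.1)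

section finiteness

variable {R : Type*} [CommRing R]

/-- The component belonging to a minimal prime `p` is the kernel of `R → R_p`. -/
lemma mem_minimalComponents_iff {q : Ideal R} (hq : q ∈ minimalComponents R) (x : R) :
    x ∈ q ↔ ∃ s, s ∉ q.radical ∧ s * x = 0 := by
  obtain ⟨t, ht, hqt, hmin⟩ := hq
  have hqp : q.IsPrimary := ht.primary hqt
  constructor
  · intro hx
    have : ¬ (t.erase q).inf id ≤ q.radical := by
      intro hle
      have hp : q.radical.IsPrime := hmin.1.1
      obtain ⟨q', hq', hle'⟩ := (Ideal.IsPrime.inf_le' hp).1 hle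
      have hq't := Finset.mem_of_mem_erase hq'
      have h1 : q'.radical ≤ q.radical := hp.radical_le_iff.2 hle'
      have h2 : q'.radical = q.radical := le_antisymm h1
        (hmin.2 ⟨Ideal.isPrime_radical (ht.primary hq't), bot_le⟩ h1)
      refine ht.distinct hq't hqt (Finset.ne_of_mem_erase hq') ?_
      simpa [Function.onFun] using h2
    obtain ⟨s, hs, hsq⟩ := SetLike.not_le_iff_exists.1 this
    refine ⟨s, hsq, ?_⟩
    have hb : s * x ∈ t.inf id := by
      rw [← Finset.insert_erase hqt, Finset.inf_insert]
      exact ⟨Ideal.mul_mem_left _ _ hx, Ideal.mul_mem_right _ _ hs⟩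
    rw [ht.inf_eq] at hb
    simpa using hb
  · rintro ⟨s, hs, hsx⟩
    have : s * x ∈ q := by rw [hsx]; exact q.zero_mem
    rw [mul_comm] at this
    rcases (Ideal.isPrimary_iff.1 hqp).2 this with h | h
    · exact h
    · exact absurd h hs

lemma radical_injOn_minimalComponents : Set.InjOn Ideal.radical (minimalComponents R) := by
  intro q hq q' hq' h
  ext x
  rw [mem_minimalComponents_iff hq, mem_minimalComponents_iff hq']
  have h' : q.radical = q'.radical := h
  rw [h']

/-- There are finitely many minimal primary components. -/
lemma finite_minimalComponents [IsNoetherianRing R] : (minimalComponents R).Finite := by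
  refine Set.Finite.of_finite_image ?_ radical_injOn_minimalComponents
  refine (minimalPrimes.finite_of_isNoetherianRing R).subset ?_
  rintro _ ⟨q, ⟨t, ht, hqt, hm⟩, rfl⟩
  exact hm

theorem complIndex_ne_top [IsNoetherianRing R] (S : Set (Ideal R)) : complIndex S ≠ ⊤ := by
  unfold complIndex
  rw [← lt_top_iff_ne_top]
  have hf := (finite_minimalComponents (R := R)).subset (Set.sdiff_subset (t := S))
  rw [← sSup_image]
  rcases (minimalComponents R \ S).eq_empty_or_nonempty with h | h
  · simp [h]
  · have := (h.image (fun q => (componentIndex q : ℕ∞))).csSup_mem (hf.image _)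
    obtain ⟨q, -, hq⟩ := this
    rw [← hq]; exact ENat.natCast_lt_top _

/-- All the suprema in the definition of `brt` are maxima of finite sets: `brt` is finite. -/
theorem brt_ne_top [IsNoetherianRing R] (𝔪 : Ideal R) : brt R 𝔪 ≠ ⊤ := by
  unfold brt
  have : Finite {S : Set (Ideal R) // S ⊆ minimalComponents R ∧ S.Nonempty} := by
    refine Set.Finite.to_subtype ((finite_minimalComponents (R := R)).finite_subsets.subset ?_)
    intro S hS; exact hS.1
  rw [ne_eq, max_eq_top, not_or]
  refine ⟨ENat.natCast_ne_top _, ?_⟩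
  rcases isEmpty_or_nonempty {S : Set (Ideal R) // S ⊆ minimalComponents R ∧ S.Nonempty} with h | h
  · simp
  · obtain ⟨S, hS⟩ := (Set.range_nonempty fun S : {S : Set (Ideal R) // S ⊆ minimalComponents R ∧ S.Nonempty} => (mult (R ⧸ sInf S.1) (𝔪.map (Ideal.Quotient.mk (sInf S.1))) : ℕ∞) + complIndex S.1).csSup_mem (Set.finite_range _)
    rw [iSup, ← hS]
    simp [complIndex_ne_top]

/-- Every minimal primary decomposition of `(0)` has the same minimal primary components. -/
lemma minimalComponents_eq {t : Finset (Ideal R)}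
    (ht : Submodule.IsMinimalPrimaryDecomposition (⊥ : Ideal R) t) :
    minimalComponents R = {q | q ∈ t ∧ q.radical ∈ minimalPrimes R} := by
  ext q; constructor
  · intro hq
    have hm : q.radical ∈ minimalPrimes R := hq.choose_spec.2.2
    obtain ⟨q', h1, h2⟩ := Ideal.IsMinimalPrimaryDecomposition.minimalPrimes_subset_image_radical ht hm
    have : q' = q := radical_injOn_minimalComponents ⟨t, ht, h1, h2 ▸ hm⟩ hq h2
    exact ⟨this ▸ h1, hm⟩
  · rintro ⟨a, b⟩; exact ⟨t, ht, a, b⟩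

end finiteness

end RelationType

end

/-! Put R = A/J, or R = A in the Cohen–Macaulay case, N = H⁰_𝔪(M) and b = brt(R). Fix an ideal I of
A. The proof has two halves.

Reductions. For every n with n + 1 ≥ b there are a finite free extension B = A[X]/(g) and f ∈ IB
with I^(n+1)B ⊆ f I^n B + ker(A → R)B (`hasReduction_of_brt_le`). The source of f is the
Eakin–Sathaye theorem: if I^(n+1) needs at most n + 1 generators modulo L, then a general f gives
I^(n+1) ⊆ f I^n + L. It is proved as linear algebra in the fibre cone over an algebraic closure of
the residue field (`eventually_span_mul_pow_eq`). Only one scalar is used, and it is algebraic, so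
it can be realised in B (`exists_adjoinRoot_reduction`). The bound on generators is the
multiplicity: in a one-dimensional Cohen–Macaulay local ring an ideal of finite colength has at most
e generators (`spanFinrank_le_mult`). This is applied to R modulo the intersection of the components
𝔮ᵢ with I ⊄ 𝔭ᵢ, where I acquires finite colength; t more factors of I then push everything into the
other components. If no such 𝔮ᵢ exists, I is nilpotent in R and the nilpotency index takes over.

Relations. Such an f acts regularly modulo N on I^(n+1)M, and with it every relation modulo N (an
element of S(I) ⊗ M with value in N) of degree n + 2 is a combination of elements of I times
relations modulo N of degree n + 1 (`mem_span_of_symTensorEval_mem`). Hence N ∩ I^(k+1)M = I(N ∩ I^k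
M) for k ≥ b. By Nakayama these submodules drop strictly until they vanish, after at most length(N)
steps. From degree b + length(N) on, relations modulo N are true relations, so the relation type is
at most b + length(N). -/

noncomputable section

namespace RelationType

/-! ### A linear Eakin–Sathaye theorem -/

section genericity

variable {K : Type*} [Field K]

/-- Rank is lower semicontinuous along a polynomial family of linear maps. -/
lemma eventually_finrank_range_le {V W : Type*} [AddCommGroup V] [Module K V] [AddCommGroup W]
    [Module K W] [FiniteDimensional K V] {s : ℕ} (T : Fin s → V →ₗ[K] W) (c₀ : K) :
    ∀ᶠ c : K in Filter.cofinite, Module.finrank K (LinearMap.range (∑ i : Fin s, c₀ ^ (i : ℕ) • T i)) ≤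
      Module.finrank K (LinearMap.range (∑ i : Fin s, c ^ (i : ℕ) • T i)) := by
  classical
  set r := Module.finrank K (LinearMap.range (∑ i : Fin s, c₀ ^ (i : ℕ) • T i)) with hr
  let b := Module.finBasisOfFinrankEq K (LinearMap.range (∑ i : Fin s, c₀ ^ (i : ℕ) • T i)) hr.symm
  choose u hu using fun j => (b j).2
  have hli : LinearIndependent K fun j => ((b j : _) : W) :=
    b.linearIndependent.map' (Submodule.subtype _) (Submodule.ker_subtype _)
  obtain ⟨φ, hφ⟩ := LinearMap.exists_leftInverse_of_injective
    (Finsupp.linearCombination K fun j => ((b j : _) : W)) (LinearMap.ker_eq_bot.2 hli)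
  have hφb (j : Fin r) : φ (b j : W) = Finsupp.single j 1 := by
    have := LinearMap.congr_fun hφ (Finsupp.single j 1)
    simpa using this
  -- The matrix of the family on the vectors `u j`, in coordinates where it is the identity at `c₀`.
  -- Its determinant is therefore a nonzero polynomial in the parameter, with finitely many roots.
  let P : Matrix (Fin r) (Fin r) K[X] := Matrix.of fun i j =>
    ∑ k : Fin s, Polynomial.C (φ (T k (u j)) i) * Polynomial.X ^ (k : ℕ)
  have hP (c : K) : P.det.eval c =
      (Matrix.of fun i j => φ ((∑ k : Fin s, c ^ (k : ℕ) • T k) (u j)) i).det := by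
    rw [← Polynomial.coe_evalRingHom, RingHom.map_det]
    congr 1
    ext i j
    simp only [P, Matrix.map_apply, Matrix.of_apply, RingHom.mapMatrix_apply,
      Polynomial.coe_evalRingHom, Polynomial.eval_finsetSum, Polynomial.eval_mul, Polynomial.eval_C,
      Polynomial.eval_pow, Polynomial.eval_X, LinearMap.sum_apply, LinearMap.smul_apply, map_sum,
      map_smul, Finsupp.coe_finsetSum, Finset.sum_apply, Finsupp.smul_apply, smul_eq_mul]
    exact Finset.sum_congr rfl fun k _ => mul_comm _ _
  have hne : P.det ≠ 0 := by
    intro h0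
    have := hP c₀
    have h1 : (Matrix.of fun i j => φ ((∑ k : Fin s, c₀ ^ (k : ℕ) • T k) (u j)) i) =
        (1 : Matrix (Fin r) (Fin r) K) := by
      ext i j
      simp only [Matrix.of_apply, hu, hφb, Finsupp.single_apply, Matrix.one_apply, eq_comm]
    rw [h1, h0] at this
    simp at this
  have hfin : {c | P.det.IsRoot c}.Finite := Polynomial.finite_setOfPred_isRoot hne
  filter_upwards [hfin.compl_mem_cofinite] with c hc
  have hdet : (Matrix.of fun i j => φ ((∑ k : Fin s, c ^ (k : ℕ) • T k) (u j)) i).det ≠ 0 := by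
    rw [← hP]; exact hc
  have hcols := Matrix.linearIndependent_cols_of_det_ne_zero hdet
  have hli' : LinearIndependent K fun j => (∑ k : Fin s, c ^ (k : ℕ) • T k) (u j) := by
    refine LinearIndependent.of_comp ((Finsupp.linearEquivFunOnFinite K K (Fin r)).toLinearMap ∘ₗ φ) ?_
    exact hcols
  have hli'' : LinearIndependent K fun j =>
      (⟨_, LinearMap.mem_range_self (∑ k : Fin s, c ^ (k : ℕ) • T k) (u j)⟩ :
        LinearMap.range (∑ k : Fin s, c ^ (k : ℕ) • T k)) :=
    LinearIndependent.of_comp (Submodule.subtype _) hli'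
  simpa using hli''.fintype_card_le_finrank

variable {F : Type*} [CommRing F] [Algebra K F] {s : ℕ} (x : Fin s → F)

/-- The point with parameter `c` of the moment curve through the span of the family `x`. -/
def momentCurve (c : K) : F := ∑ i : Fin s, c ^ (i : ℕ) • x i

lemma momentCurve_mem (c : K) : momentCurve x c ∈ Submodule.span K (Set.range x) :=
  Submodule.sum_mem _ fun i _ =>
    Submodule.smul_mem _ _ (Submodule.subset_span (Set.mem_range_self i))

/-- Infinitely many points of the moment curve span. -/
lemma span_range_le_of_momentCurve_mem {Z : Set K} (hZ : Z.Infinite) (U : Submodule K F)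
    (h : ∀ c ∈ Z, momentCurve x c ∈ U) : Submodule.span K (Set.range x) ≤ U := by
  rw [Submodule.span_le]
  rintro _ ⟨i, rfl⟩
  by_contra hi
  obtain ⟨φ, hφ, hU⟩ := Submodule.exists_le_ker_of_notMem hi
  let p : K[X] := ∑ k : Fin s, Polynomial.monomial (k : ℕ) (φ (x k))
  have hp : p = 0 := by
    refine Polynomial.eq_zero_of_infinite_isRoot p (hZ.mono fun c hc => ?_)
    have := hU (h c hc)
    simp only [LinearMap.mem_ker, momentCurve, map_sum, map_smul, smul_eq_mul] at this
    simp only [p, Set.mem_ofPred_eq, Polynomial.IsRoot.def, Polynomial.eval_finsetSum, Polynomial.eval_monomial]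
    rw [← this]
    exact Finset.sum_congr rfl fun k _ => mul_comm _ _
  apply hφ
  have := congrArg (fun q => Polynomial.coeff q (i : ℕ)) hp
  simpa [p, Polynomial.finsetSum_coeff, Polynomial.coeff_monomial, Fin.val_inj] using this

lemma eventually_finrank_momentCurve_mul_le (U : Submodule K F) [FiniteDimensional K U] (c₀ : K) :
    ∀ᶠ c : K in Filter.cofinite,
      Module.finrank K (Submodule.span K {momentCurve x c₀} * U : Submodule K F) ≤
        Module.finrank K (Submodule.span K {momentCurve x c} * U : Submodule K F) := by
  have key (c : K) : (Submodule.span K {momentCurve x c} * U : Submodule K F) =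
      LinearMap.range (∑ i : Fin s, c ^ (i : ℕ) • (LinearMap.mulLeft K (x i) ∘ₗ U.subtype)) := by
    ext z
    simp only [Submodule.mem_span_singleton_mul, LinearMap.mem_range, LinearMap.sum_apply, LinearMap.smul_apply,
      LinearMap.comp_apply, LinearMap.mulLeft_apply, momentCurve, Finset.sum_mul, smul_mul_assoc,
      Subtype.exists, Submodule.subtype_apply, exists_prop]
  filter_upwards [eventually_finrank_range_le
    (fun i => LinearMap.mulLeft K (x i) ∘ₗ U.subtype) c₀] with c hc
  rwa [← key, ← key] at hc

lemma span_singleton_mul_span_singleton (a b : F) :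
    (Submodule.span K {a} * Submodule.span K {b} : Submodule K F) = Submodule.span K {a * b} := by
  rw [Submodule.span_mul_span, Set.singleton_mul_singleton]

/-- A linear version of the theorem of Eakin and Sathaye. -/
theorem eventually_span_mul_pow_eq [Infinite K] (n : ℕ) (w : F)
    (h : Module.finrank K (Submodule.span K {w} * Submodule.span K (Set.range x) ^ (n + 1) :
      Submodule K F) ≤ n + 1) :
    ∀ᶠ c : K in Filter.cofinite, Submodule.span K {w} * Submodule.span K (Set.range x) ^ (n + 1) =
      Submodule.span K {momentCurve x c} * (Submodule.span K {w} *
        Submodule.span K (Set.range x) ^ n) := by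
  induction n using Nat.strong_induction_on generalizing w with
  | _ n ih =>
  have hfg (n : ℕ) : FiniteDimensional K
      (Submodule.span K {w} * Submodule.span K (Set.range x) ^ n : Submodule K F) :=
    Module.Finite.iff_fg.2 ((Submodule.fg_span_singleton w).mul
      ((Submodule.fg_span (Set.finite_range x)).pow n))
  set V := Submodule.span K (Set.range x) with hV
  have hle (c : K) : Submodule.span K {momentCurve x c} * (Submodule.span K {w} * V ^ n) ≤
      Submodule.span K {w} * V ^ (n + 1) := by
    rw [pow_succ', mul_left_comm]
    refine mul_le_mul' le_rfl (mul_le_mul' ?_ le_rfl)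
    exact (Submodule.span_singleton_le_iff_mem _ _).2 (momentCurve_mem x c)
  -- If the equality fails for infinitely many `c`, semicontinuity forbids it at every parameter, so
  -- all the products have dimension at most `n`, as the induction hypothesis requires.
  by_contra hcon
  have hne (c₀ : K) : Submodule.span K {momentCurve x c₀} * (Submodule.span K {w} * V ^ n) ≠
      Submodule.span K {w} * V ^ (n + 1) := by
    intro h0
    apply hcon
    filter_upwards [eventually_finrank_momentCurve_mul_le x (Submodule.span K {w} * V ^ n) c₀]
      with c hc
    rw [h0] at hc
    exact (Submodule.eq_of_le_of_finrank_le (hle c) hc).symm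
  have hlt (c : K) : Module.finrank K
      (Submodule.span K {momentCurve x c} * (Submodule.span K {w} * V ^ n) : Submodule K F) ≤ n := by
    have := Submodule.finrank_lt_finrank_of_lt (lt_of_le_of_ne (hle c) (hne c))
    omega
  obtain ⟨c₀, hmax⟩ : ∃ c₀ : K, ∀ c : K, Module.finrank K
      (Submodule.span K {momentCurve x c} * (Submodule.span K {w} * V ^ n) : Submodule K F) ≤
      Module.finrank K
      (Submodule.span K {momentCurve x c₀} * (Submodule.span K {w} * V ^ n) : Submodule K F) := by
    have hb : BddAbove (Set.range fun c : K => Module.finrank K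
      (Submodule.span K {momentCurve x c} * (Submodule.span K {w} * V ^ n) : Submodule K F)) :=
      ⟨n, by rintro _ ⟨c, rfl⟩; exact hlt c⟩
    obtain ⟨c₀, h0⟩ := Nat.sSup_mem (Set.range_nonempty _) hb
    exact ⟨c₀, fun c => (le_csSup hb ⟨c, rfl⟩).trans_eq h0.symm⟩
  -- The induction hypothesis for ℓ(c₀)w, where ℓ is the moment curve, puts ℓ(c₀)wVⁿ inside ℓ(c)wVⁿ
  -- for almost all `c`. Maximality at `c₀` makes the two equal. For `n = 0` all these spaces
  -- vanish.
  have hst : ∀ᶠ c : K in Filter.cofinite,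
      Submodule.span K {momentCurve x c} * (Submodule.span K {w} * V ^ n) ≤
      Submodule.span K {momentCurve x c₀} * (Submodule.span K {w} * V ^ n) := by
    rcases n with _ | m
    · refine Filter.Eventually.of_forall fun c => ?_
      have hf : FiniteDimensional K (Submodule.span K {momentCurve x c} *
          (Submodule.span K {w} * V ^ 0) : Submodule K F) :=
        Module.Finite.iff_fg.2 ((Submodule.fg_span_singleton _).mul (Module.Finite.iff_fg.1 (hfg 0)))
      rw [Submodule.finrank_eq_zero.1 (Nat.le_zero.1 (hlt c))]
      exact bot_le
    · have hIH := ih m (Nat.lt_succ_self m) (momentCurve x c₀ * w) (by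
        rw [← span_singleton_mul_span_singleton, mul_assoc]
        exact hlt c₀)
      filter_upwards [hIH] with c hc
      have hf : FiniteDimensional K (Submodule.span K {momentCurve x c} *
          (Submodule.span K {w} * V ^ (m + 1)) : Submodule K F) :=
        Module.Finite.iff_fg.2 ((Submodule.fg_span_singleton _).mul
          (Module.Finite.iff_fg.1 (hfg (m + 1))))
      refine (Submodule.eq_of_le_of_finrank_le ?_ (hmax c)).ge
      rw [← mul_assoc, span_singleton_mul_span_singleton, hc]
      refine mul_le_mul' le_rfl ?_
      rw [pow_succ', mul_left_comm _ V, ← span_singleton_mul_span_singleton, mul_assoc]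
      refine mul_le_mul' ?_ le_rfl
      exact (Submodule.span_singleton_le_iff_mem _ _).2 (momentCurve_mem x c₀)
  -- Infinitely many ℓ(c) now multiply wVⁿ into the single space ℓ(c₀)wVⁿ. They span V, so equality
  -- holds at `c₀` after all.
  refine hne c₀ (le_antisymm (hle c₀) ?_)
  rw [pow_succ', mul_left_comm, Submodule.mul_le]
  intro v hv u hu
  have hVle : V ≤ (Submodule.span K {momentCurve x c₀} * (Submodule.span K {w} * V ^ n)).comap
      (LinearMap.mulRight K u) := by
    refine span_range_le_of_momentCurve_mem x (Filter.frequently_cofinite_iff_infinite.1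
      hst.frequently) _ fun c hc => hc ?_
    exact Submodule.mul_mem_mul (Submodule.mem_span_singleton_self _) hu
  exact hVle hv

end genericity

/-! ### The fibre cone of an ideal modulo `L` -/

section fiberCone

variable {A : Type*} [CommRing A] (K : Type*) [Field K] [Algebra A K] (I L : Ideal A)

/-- The fibre over `A → K` of the Rees algebra of the image of `I` in `A ⧸ L`. -/
abbrev FiberCone : Type _ := K ⊗[A] reesAlgebra (I.map (Ideal.Quotient.mk L))

variable {K I L} in
lemma mk_mem_map_pow {n : ℕ} {z : A} (hz : z ∈ I ^ n) :
    Ideal.Quotient.mk L z ∈ I.map (Ideal.Quotient.mk L) ^ n := by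
  rw [← Ideal.map_pow]
  exact Ideal.mem_map_of_mem _ hz

/-- The map `Iⁿ → R(I(A/L))`, `z ↦ z tⁿ`. -/
def reesMonomial (n : ℕ) : ↥(I ^ n) →ₗ[A] reesAlgebra (I.map (Ideal.Quotient.mk L)) where
  toFun z := ⟨Polynomial.monomial n (Ideal.Quotient.mk L z.1),
    reesAlgebra.monomial_mem.2 (mk_mem_map_pow z.2)⟩
  map_add' z w := by ext1; simp
  map_smul' a z := by
    ext1
    change Polynomial.monomial n (Ideal.Quotient.mk L (a * z.1)) =
      a • Polynomial.monomial n (Ideal.Quotient.mk L z.1)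
    rw [Polynomial.smul_monomial, map_mul]
    rfl

/-- The map `Iⁿ → F(I)ₙ`. -/
def fiberConeMap (n : ℕ) : ↥(I ^ n) →ₗ[A] FiberCone K I L :=
  TensorProduct.mk A K _ 1 ∘ₗ reesMonomial I L n

lemma fiberConeMap_mul {n m : ℕ} (z : ↥(I ^ n)) (w : ↥(I ^ m)) :
    fiberConeMap K I L n z * fiberConeMap K I L m w =
      fiberConeMap K I L (n + m) ⟨z.1 * w.1, by rw [pow_add]; exact Ideal.mul_mem_mul z.2 w.2⟩ := by
  simp only [fiberConeMap, LinearMap.comp_apply, TensorProduct.mk_apply,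
    Algebra.TensorProduct.tmul_mul_tmul, mul_one]
  congr 1
  ext1
  simp [reesMonomial, Polynomial.monomial_mul_monomial]

lemma fiberConeMap_eq_zero {n : ℕ} (z : ↥(I ^ n)) (hz : z.1 ∈ L) :
    fiberConeMap K I L n z = 0 := by
  have : reesMonomial I L n z = 0 := by
    ext1
    simp [reesMonomial, Ideal.Quotient.eq_zero_iff_mem.2 hz]
  simp [fiberConeMap, this]

/-- The degree `n` component of the fibre cone. -/
def fiberConeDegree (n : ℕ) : Submodule K (FiberCone K I L) :=
  Submodule.span K (Set.range (fiberConeMap K I L n))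

/-- Presents the graded pieces as powers of one finitely spanned subspace, the form to which the
linear Eakin–Sathaye theorem applies. -/
lemma fiberConeDegree_eq_pow {s : ℕ} (x : Fin s → ↥(I ^ 1))
    (hx : Submodule.span A (Set.range x) = ⊤) (n : ℕ) :
    fiberConeDegree K I L n = Submodule.span K (Set.range fun i => fiberConeMap K I L 1 (x i)) ^ n := by
  have h1 : Submodule.span K (Set.range fun i => fiberConeMap K I L 1 (x i)) =
      fiberConeDegree K I L 1 := by
    refine le_antisymm (Submodule.span_mono (Set.range_comp_subset_range x _)) ?_
    rw [fiberConeDegree, Submodule.span_le]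
    rintro _ ⟨z, rfl⟩
    have hz : z ∈ Submodule.span A (Set.range x) := hx ▸ Submodule.mem_top
    have := Submodule.mem_map_of_mem (f := fiberConeMap K I L 1) hz
    rw [Submodule.map_span, ← Set.range_comp] at this
    exact Submodule.span_le_restrictScalars A K _ this
  rw [h1]
  induction n with
  | zero =>
    rw [pow_zero, Submodule.one_eq_span]
    refine le_antisymm ?_ ?_
    · rw [fiberConeDegree, Submodule.span_le]
      rintro _ ⟨z, rfl⟩
      have : fiberConeMap K I L 0 z = z.1 • (1 : FiberCone K I L) := by
        rw [Algebra.TensorProduct.one_def, ← TensorProduct.tmul_smul]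
        change (1 : K) ⊗ₜ[A] _ = _
        congr 1
        ext1
        simp only [Algebra.smul_def, mul_one]
        rfl
      rw [this, ← algebraMap_smul K z.1]
      exact Submodule.smul_mem _ _ (Submodule.mem_span_singleton_self _)
    · refine (Submodule.span_singleton_le_iff_mem _ _).2 ?_
      have : (1 : FiberCone K I L) = fiberConeMap K I L 0 ⟨1, by simp⟩ := by
        change (1 : K) ⊗ₜ[A] _ = (1 : K) ⊗ₜ[A] _
        congr 1
      rw [this]
      exact Submodule.subset_span ⟨_, rfl⟩
  | succ n ih =>
    rw [pow_succ, ← ih]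
    refine le_antisymm ?_ ?_
    · rw [fiberConeDegree, Submodule.span_le]
      rintro _ ⟨⟨z, hz⟩, rfl⟩
      rw [pow_succ] at hz
      refine Submodule.mul_induction_on' (C := fun z hz => fiberConeMap K I L (n + 1)
        ⟨z, by rwa [pow_succ]⟩ ∈ fiberConeDegree K I L n * fiberConeDegree K I L 1) ?_ ?_ hz
      · intro a ha b hb
        rw [← pow_one I] at hb
        have := fiberConeMap_mul K I L (⟨a, ha⟩ : ↥(I ^ n)) (⟨b, hb⟩ : ↥(I ^ 1))
        rw [← this]
        exact Submodule.mul_mem_mul (Submodule.subset_span ⟨_, rfl⟩) (Submodule.subset_span ⟨_, rfl⟩)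
      · intro a ha b hb h h'
        have := Submodule.add_mem _ h h'
        rwa [← map_add] at this
    · rw [fiberConeDegree, fiberConeDegree, Submodule.span_mul_span, Submodule.span_le]
      rintro _ ⟨_, ⟨z, rfl⟩, _, ⟨w, rfl⟩, rfl⟩
      change fiberConeMap K I L n z * fiberConeMap K I L 1 w ∈ _
      rw [fiberConeMap_mul]
      exact Submodule.subset_span ⟨_, rfl⟩

/-- Elements of `L` die in the fibre cone, so generators modulo `L` already span. -/
lemma finrank_fiberConeDegree_le {n : ℕ} (Y : Finset ↥(I ^ n))
    (hY : Submodule.span A (Y : Set ↥(I ^ n)) ⊔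
      Submodule.comap (Submodule.subtype (I ^ n : Ideal A)) L = ⊤) :
    Module.finrank K (fiberConeDegree K I L n) ≤ Y.card := by
  classical
  have hle : fiberConeDegree K I L n ≤
      Submodule.span K (Y.image (fiberConeMap K I L n) : Set (FiberCone K I L)) := by
    rw [fiberConeDegree, Submodule.span_le]
    rintro _ ⟨z, rfl⟩
    obtain ⟨y, hy, l, hl, hyl⟩ := Submodule.mem_sup.1 (hY ▸ Submodule.mem_top : z ∈ _)
    rw [← hyl, map_add, fiberConeMap_eq_zero K I L l hl, add_zero, Finset.coe_image]
    have := Submodule.mem_map_of_mem (f := fiberConeMap K I L n) hy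
    rw [Submodule.map_span] at this
    exact Submodule.span_le_restrictScalars A K _ this
  exact (Submodule.finrank_mono hle).trans
    ((finrank_span_finset_le_card _).trans Finset.card_image_le)

end fiberCone

/-! ### Realising an algebraic scalar in a finite free extension -/

section extension

variable {A : Type*} [CommRing A] [IsLocalRing A]

/-- A monic lift of the minimal polynomial of an element of an algebraic extension of the residue
field. -/
lemma exists_monic_lift {K : Type*} [Field K] [Algebra A K] [Algebra (ResidueField A) K]
    [IsScalarTower A (ResidueField A) K] (c : K) (hc : IsIntegral (ResidueField A) c) :
    ∃ g : A[X], g.Monic ∧ g.natDegree ≠ 0 ∧ Polynomial.aeval c g = 0 ∧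
      ∀ h : A[X], Polynomial.aeval c h = 0 →
        ∃ q : A[X], h - g * q ∈ (maximalIdeal A).map Polynomial.C := by
  have hsurj : Function.Surjective (Polynomial.mapRingHom (residue A)) :=
    Polynomial.map_surjective _ residue_surjective
  have hl : minpoly (ResidueField A) c ∈ Polynomial.lifts (residue A) := hsurj _
  obtain ⟨g, hg, hdeg, hmon⟩ :=
    Polynomial.lifts_and_natDegree_eq_and_monic hl (minpoly.monic hc)
  have haev (h : A[X]) : Polynomial.aeval c h = Polynomial.aeval c (h.map (residue A)) :=
    (Polynomial.aeval_map_algebraMap (ResidueField A) c h).symm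
  refine ⟨g, hmon, ?_, ?_, fun h hh => ?_⟩
  · rw [hdeg]
    exact (minpoly.natDegree_pos hc).ne'
  · rw [haev, hg, minpoly.aeval]
  -- Divisibility by the minimal polynomial over the residue field lifts to `A`. It says that 𝔪
  -- generates the kernel of A[X]/(g) → K.
  · rw [haev] at hh
    obtain ⟨q', hq'⟩ := minpoly.dvd _ _ hh
    obtain ⟨q, hq⟩ := hsurj q'
    refine ⟨q, ?_⟩
    rw [Ideal.mem_map_C_iff]
    intro n
    rw [← residue_eq_zero_iff, ← Polynomial.coeff_map]
    have hq2 : q.map (residue A) = q' := hq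
    rw [Polynomial.map_sub, Polynomial.map_mul, hg, hq2, hq', sub_self, Polynomial.coeff_zero]

end extension

/-! ### From few generators to a one-element reduction -/

section reduction

/-- A finitely generated module over a ring whose only maximal ideal is the kernel of `ρ : B → K`
has a nonzero functional with values in `K`. -/
lemma exists_semilinear_functional {B K : Type*} [CommRing B] [IsNoetherianRing B] [Field K]
    (ρ : B →+* K) (hρ : ∀ P : Ideal B, P.IsMaximal → P = RingHom.ker ρ) {D W : Ideal B}
    (h : ¬ D ≤ W) :
    ∃ η : D →ₛₗ[ρ] K, (∀ d : D, d.1 ∈ W → η d = 0) ∧ ∃ d, η d ≠ 0 := by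
  have hne : Submodule.comap D.subtype W ≠ ⊤ := by
    intro h'
    exact h fun d hd => (h' ▸ Submodule.mem_top : (⟨d, hd⟩ : D) ∈ Submodule.comap D.subtype W)
  obtain ⟨N, hN, hle⟩ := (eq_top_or_exists_le_coatom _).resolve_left hne
  have hs : IsSimpleModule B (D ⧸ N) := isSimpleModule_iff_isCoatom.2 hN
  obtain ⟨P, hP, ⟨e⟩⟩ := isSimpleModule_iff_quot_maximal.1 hs
  obtain rfl := hρ P hP
  let ι : (B ⧸ RingHom.ker ρ) →ₛₗ[ρ] K :=
    { toFun := RingHom.kerLift ρ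
      map_add' := map_add _
      map_smul' := fun b q => by
        obtain ⟨q, rfl⟩ := Ideal.Quotient.mk_surjective q
        exact map_mul ρ _ _ }
  have hι : Function.Injective ι := RingHom.kerLift_injective ρ
  refine ⟨ι.comp (e.toLinearMap ∘ₗ N.mkQ), fun d hd => ?_, ?_⟩
  · have : N.mkQ d = 0 := (Submodule.Quotient.mk_eq_zero _).2 (hle hd)
    simp [this]
  · obtain ⟨d, hd⟩ : ∃ d, d ∉ N := by
      by_contra! hall
      exact hN.1 (eq_top_iff.2 fun d _ => hall d)
    refine ⟨d, fun h0 => hd ?_⟩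
    have := hι (h0.trans (map_zero ι).symm)
    simpa using this

variable {A : Type*} [CommRing A] [IsLocalRing A]

/-- A linear map on `Iⁿ` which vanishes on `L` factors through the Rees algebra of `I (A/L)`. -/
lemma exists_comp_reesMonomial_eq {A K : Type*} [CommRing A] [AddCommGroup K] [Module A K] (I L : Ideal A) (n : ℕ)
    (η : ↥(I ^ n) →ₗ[A] K) (hη : ∀ z, z.1 ∈ L → η z = 0) :
    ∃ Ψ : reesAlgebra (I.map (Ideal.Quotient.mk L)) →ₗ[A] K, ∀ z, Ψ (reesMonomial I L n z) = η z := by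
  let π : ↥(I ^ n) →ₗ[A] ↥(I.map (Ideal.Quotient.mk L) ^ n) :=
    { toFun := fun z => ⟨Ideal.Quotient.mk L z.1, mk_mem_map_pow z.2⟩
      map_add' := fun z w => by ext1; simp
      map_smul' := fun a z => by
        ext1
        change Ideal.Quotient.mk L (a * z.1) = a • Ideal.Quotient.mk L z.1
        rw [map_mul]
        rfl }
  have hπ : Function.Surjective π := by
    rintro ⟨w, hw⟩
    rw [← Ideal.map_pow] at hw
    obtain ⟨z, hz, rfl⟩ := (Ideal.mem_map_iff_of_surjective _ Ideal.Quotient.mk_surjective).1 hw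
    exact ⟨⟨z, hz⟩, rfl⟩
  let co : reesAlgebra (I.map (Ideal.Quotient.mk L)) →ₗ[A] ↥(I.map (Ideal.Quotient.mk L) ^ n) :=
    { toFun := fun r => ⟨r.1.coeff n, r.2 n⟩
      map_add' := fun r t => by ext1; simp
      map_smul' := fun a r => by
        ext1
        change (a • r.1).coeff n = a • r.1.coeff n
        rw [Polynomial.coeff_smul] }
  have hker : LinearMap.ker π ≤ LinearMap.ker η := fun z hz =>
    hη z (Ideal.Quotient.eq_zero_iff_mem.1 (congrArg Subtype.val hz))
  refine ⟨(LinearMap.ker π).liftQ η hker ∘ₗ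
    (π.quotKerEquivOfSurjective hπ).symm.toLinearMap ∘ₗ co, fun z => ?_⟩
  have hco : co (reesMonomial I L n z) = π z := by
    ext1
    simp [co, reesMonomial, π]
  have : (π.quotKerEquivOfSurjective hπ).symm (π z) = (LinearMap.ker π).mkQ z := by
    rw [LinearEquiv.symm_apply_eq]
    rfl
  simp [hco, this]

/-- By integrality a maximal ideal of `B` lies over 𝔪, so it contains 𝔪B and hence ker ρ. The prime
ker ρ also lies over 𝔪, so it is maximal itself. -/
lemma ker_eq_of_isMaximal {B K : Type*} [CommRing B] [Algebra A B] [Algebra.IsIntegral A B] [Field K]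
    [Algebra A K] (hK : RingHom.ker (algebraMap A K) = maximalIdeal A) (ρ : B →ₐ[A] K)
    (hρ : RingHom.ker ρ ≤ (maximalIdeal A).map (algebraMap A B)) {P : Ideal B} (hP : P.IsMaximal) :
    P = RingHom.ker ρ := by
  have h1 : P.comap (algebraMap A B) = maximalIdeal A :=
    eq_maximalIdeal (Ideal.isMaximal_comap_of_isIntegral_of_isMaximal P)
  have hprime : (RingHom.ker ρ).IsPrime := RingHom.ker_isPrime ρ
  have h2 : (RingHom.ker ρ).comap (algebraMap A B) = maximalIdeal A := by
    rw [← hK]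
    ext a
    simp [RingHom.mem_ker]
  have hmax : (RingHom.ker ρ).IsMaximal :=
    Ideal.isMaximal_of_isIntegral_of_isMaximal_comap _ (h2 ▸ maximalIdeal.isMaximal A)
  exact (hmax.eq_of_le hP.ne_top (hρ.trans (Ideal.map_le_iff_le_comap.2 h1.ge))).symm

/-- If `I ^ (n + 1)` is generated modulo `L` by at most `n + 1` elements, then after a finite free
extension of `A` there is `f ∈ I` with `I ^ (n + 1) ⊆ f I ^ n + L`. -/
theorem exists_adjoinRoot_reduction [IsNoetherianRing A] (I L : Ideal A) {n : ℕ}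
    (Y : Finset ↥(I ^ (n + 1)))
    (hY : Submodule.span A (Y : Set ↥(I ^ (n + 1))) ⊔
      Submodule.comap (Submodule.subtype (I ^ (n + 1) : Ideal A)) L = ⊤) (hcard : Y.card ≤ n + 1) :
    ∃ g : A[X], g.Monic ∧ g.natDegree ≠ 0 ∧ ∃ f ∈ I.map (algebraMap A (AdjoinRoot g)),
      (I ^ (n + 1)).map (algebraMap A (AdjoinRoot g)) ≤
        Ideal.span {f} * (I ^ n).map (algebraMap A (AdjoinRoot g)) ⊔
          L.map (algebraMap A (AdjoinRoot g)) := by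
  classical
  -- An algebraic closure is infinite, so a good parameter exists, and algebraic, so that parameter
  -- has a monic equation liftable to `A`.
  let K := AlgebraicClosure (ResidueField A)
  have hK : RingHom.ker (algebraMap A K) = maximalIdeal A := by
    rw [IsScalarTower.algebraMap_eq A (ResidueField A) K]
    ext a
    rw [RingHom.mem_ker, RingHom.comp_apply, map_eq_zero]
    exact residue_eq_zero_iff a
  have hfg : (⊤ : Submodule A ↥(I ^ 1)).FG := IsNoetherian.noetherian _
  obtain ⟨s, x, hx⟩ := Submodule.fg_iff_exists_fin_generating_family.1 hfg
  have hdeg := fiberConeDegree_eq_pow K I L x hx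
  obtain ⟨c, hc⟩ := (eventually_span_mul_pow_eq (K := K)
    (fun i => fiberConeMap K I L 1 (x i)) n 1 (by
      rw [← hdeg, ← Submodule.one_eq_span, one_mul]
      exact (finrank_fiberConeDegree_le K I L Y hY).trans hcard)).exists
  rw [← hdeg, ← hdeg, ← Submodule.one_eq_span, one_mul, one_mul] at hc
  obtain ⟨g, hg, hgd, hgc, hlift⟩ := exists_monic_lift (A := A) c (Algebra.IsIntegral.isIntegral c)
  let B := AdjoinRoot g
  have : Module.Finite A B := hg.finite_adjoinRoot
  have : IsNoetherianRing B := IsNoetherianRing.of_finite A B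
  let ρ : B →ₐ[A] K := AdjoinRoot.liftAlgHom g (Algebra.ofId A K) c hgc
  have hρ : RingHom.ker ρ ≤ (maximalIdeal A).map (algebraMap A B) := by
    intro b hb
    obtain ⟨h, rfl⟩ := AdjoinRoot.mk_surjective b
    have hb' : Polynomial.aeval c h = 0 := hb
    obtain ⟨q, hq⟩ := hlift h hb'
    have := Ideal.mem_map_of_mem (AdjoinRoot.mk g) hq
    rwa [Ideal.map_map, map_sub, map_mul, AdjoinRoot.mk_self, zero_mul, sub_zero] at this
  -- A lift of the chosen point of the moment curve: ρ sends the root to `c`.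
  let f : B := ∑ i : Fin s, algebraMap A B (x i).1 * AdjoinRoot.root g ^ (i : ℕ)
  have hf : f ∈ I.map (algebraMap A B) := Ideal.sum_mem _ fun i _ =>
    Ideal.mul_mem_right _ _ (Ideal.mem_map_of_mem _ (by simpa using (x i).2))
  refine ⟨g, hg, hgd, f, hf, ?_⟩
  -- In place of Nakayama: a functional `η` kills the right side but not all of the left. Restricted
  -- to `I ^ (n + 1)` it kills `L`, so it factors through the fibre cone, where `hc` forces it to
  -- vanish.
  by_contra hnot
  obtain ⟨η, hη0, d, hd⟩ := exists_semilinear_functional (ρ : B →+* K)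
    (fun P hP => ker_eq_of_isMaximal hK ρ hρ hP) hnot
  let η₀ : ↥(I ^ (n + 1)) →ₗ[A] K :=
    { toFun := fun z => η ⟨algebraMap A B z.1, Ideal.mem_map_of_mem _ z.2⟩
      map_add' := fun z w => by
        rw [← map_add]
        exact congrArg η (Subtype.ext (map_add _ _ _))
      map_smul' := fun a z => by
        rw [RingHom.id_apply, Algebra.smul_def, ← AlgHom.commutes ρ a]
        exact (congrArg η (Subtype.ext (map_mul _ _ _))).trans (map_smulₛₗ η (algebraMap A B a) _) }
  obtain ⟨Ψ, hΨ⟩ := exists_comp_reesMonomial_eq I L (n + 1) η₀ fun z hz =>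
    hη0 _ (Ideal.mem_sup_right (Ideal.mem_map_of_mem _ hz))
  let Φ : FiberCone K I L →ₗ[K] K := LinearMap.liftBaseChange K Ψ
  have hΦ (z : ↥(I ^ (n + 1))) : Φ (fiberConeMap K I L (n + 1) z) = η₀ z := by
    simp [Φ, fiberConeMap, hΨ]
  have hkill : fiberConeDegree K I L (n + 1) ≤ LinearMap.ker Φ := by
    rw [hc, fiberConeDegree, Submodule.span_mul_span, Submodule.span_le]
    rintro _ ⟨_, rfl, _, ⟨z, rfl⟩, rfl⟩
    change Φ (momentCurve _ c * _) = 0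
    have hxz (i : Fin s) : (x i).1 * z.1 ∈ I ^ (n + 1) := by
      rw [pow_succ']
      exact Ideal.mul_mem_mul (by simpa using (x i).2) z.2
    have hmul (i : Fin s) : fiberConeMap K I L 1 (x i) * fiberConeMap K I L n z =
        fiberConeMap K I L (n + 1) ⟨(x i).1 * z.1, hxz i⟩ := by
      rw [fiberConeMap_mul]
      exact congrArg (TensorProduct.mk A K _ 1) (Subtype.ext (by simp [reesMonomial, add_comm]))
    simp only [momentCurve, Finset.sum_mul, smul_mul_assoc, hmul, map_sum, map_smul, hΦ]
    let y (i : Fin s) : ↥((I ^ (n + 1)).map (algebraMap A B)) :=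
      ⟨algebraMap A B ((x i).1 * z.1), Ideal.mem_map_of_mem _ (hxz i)⟩
    have hroot : ρ (AdjoinRoot.root g) = c := AdjoinRoot.liftAlgHom_root _ _ _ _
    have hsum : ∑ i : Fin s, c ^ (i : ℕ) • η₀ ⟨(x i).1 * z.1, hxz i⟩ =
        η (∑ i : Fin s, AdjoinRoot.root g ^ (i : ℕ) • y i) := by
      rw [map_sum]
      refine Finset.sum_congr rfl fun i _ => ?_
      rw [map_smulₛₗ, map_pow]
      change _ = ρ (AdjoinRoot.root g) ^ (i : ℕ) • _
      rw [hroot]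
      rfl
    rw [hsum]
    refine hη0 _ (Ideal.mem_sup_left ?_)
    have : ((∑ i : Fin s, AdjoinRoot.root g ^ (i : ℕ) • y i : _) : B) = f * algebraMap A B z.1 := by
      simp only [Submodule.coe_sum, Submodule.coe_smul, smul_eq_mul, y, f, Finset.sum_mul, map_mul]
      exact Finset.sum_congr rfl fun i _ => by ring
    rw [this]
    exact Ideal.mul_mem_mul (Ideal.mem_span_singleton_self f) (Ideal.mem_map_of_mem _ z.2)
  refine hd ?_
  obtain ⟨d, hmem⟩ := d
  refine Submodule.span_induction (p := fun b hb => η ⟨b, hb⟩ = 0) ?_ ?_ ?_ ?_ hmem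
  · rintro _ ⟨z, hz, rfl⟩
    have := hkill (Submodule.subset_span ⟨⟨z, hz⟩, rfl⟩)
    rw [LinearMap.mem_ker, hΦ] at this
    exact this
  · exact map_zero η
  · intro a b ha hb h h'
    refine (map_add η ⟨a, ha⟩ ⟨b, hb⟩).trans ?_
    exact (congrArg₂ (· + ·) h h').trans (add_zero _)
  · intro a b hb h
    refine (map_smulₛₗ η a ⟨b, hb⟩).trans ?_
    exact (congrArg (ρ a • ·) h).trans (smul_zero _)

end reduction

/-! ### Colengths and numbers of generators -/

section length

variable {C : Type*} [CommRing C] {B : Type*} [CommRing B] [Algebra C B]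

lemma length_quotient_map [StrongRankCondition C] [Module.Free C B] [Module.Finite C B]
    (I : Ideal C) :
    Module.length C (B ⧸ I.map (algebraMap C B)) =
      Module.finrank C B * Module.length C (C ⧸ I) := by
  classical
  let b := Module.Free.chooseBasis C B
  let e₁ : (B ⧸ (I • ⊤ : Submodule C B)) ≃ₗ[C] B ⧸ (I.map (algebraMap C B)).restrictScalars C :=
    Submodule.quotEquivOfEq _ _ (Ideal.smul_top_eq_map I)
  let e₂ : (B ⧸ (I.map (algebraMap C B)).restrictScalars C) ≃ₗ[C] B ⧸ I.map (algebraMap C B) :=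
    Submodule.Quotient.restrictScalarsEquiv C _
  have e : (B ⧸ I.map (algebraMap C B)) ≃ₗ[C] (Module.Free.ChooseBasisIndex C B → C ⧸ I) :=
    e₂.symm ≪≫ₗ e₁.symm ≪≫ₗ (TensorProduct.quotTensorEquivQuotSMul B I).symm ≪≫ₗ
      (b.equivFun.lTensor (C ⧸ I)) ≪≫ₗ TensorProduct.piScalarRight C C (C ⧸ I) _
  rw [e.length_eq, Module.length_pi_of_fintype, Finset.sum_const, Finset.card_univ, nsmul_eq_mul,
    Module.finrank_eq_card_chooseBasisIndex]

variable (C) in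
-- Additivity of length in 0 → B/D → B/fD → B/fB → 0, whose first map is multiplication by the
-- regular element `f`.
lemma length_quotient_span_mul {f : B} (hf : f ∈ nonZeroDivisors B) (D : Ideal B) :
    Module.length C (B ⧸ Ideal.span {f} * D) =
      Module.length C (B ⧸ D) + Module.length C (B ⧸ Ideal.span {f}) := by
  have h₁ : D ≤ Submodule.comap (LinearMap.mulLeft B f) (Ideal.span {f} * D) := fun d hd =>
    Ideal.mul_mem_mul (Ideal.mem_span_singleton_self f) hd
  have h₂ : Ideal.span {f} * D ≤ Ideal.span {f} := Ideal.mul_le_left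
  refine Module.length_eq_add_of_exact ((Submodule.mapQ D _ _ h₁).restrictScalars C)
    ((Submodule.factor h₂).restrictScalars C) ?_ ?_ ?_
  · rw [injective_iff_map_eq_zero]
    intro x hx
    obtain ⟨x, rfl⟩ := Ideal.Quotient.mk_surjective x
    have hx' : f * x ∈ Ideal.span {f} * D := (Submodule.Quotient.mk_eq_zero _).1 hx
    obtain ⟨d, hd, hdx⟩ := Ideal.mem_span_singleton_mul.1 hx'
    rw [Ideal.Quotient.eq_zero_iff_mem]
    rwa [← (mul_cancel_left_mem_nonZeroDivisors hf).1 hdx]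
  · intro x
    obtain ⟨x, rfl⟩ := Ideal.Quotient.mk_surjective x
    exact ⟨Ideal.Quotient.mk _ x, rfl⟩
  · intro x
    obtain ⟨x, rfl⟩ := Ideal.Quotient.mk_surjective x
    constructor
    · intro hx
      have hx' : x ∈ Ideal.span {f} := (Submodule.Quotient.mk_eq_zero _).1 hx
      obtain ⟨y, rfl⟩ := Ideal.mem_span_singleton'.1 hx'
      refine ⟨Ideal.Quotient.mk _ y, ?_⟩
      change Ideal.Quotient.mk _ (f * y) = _
      rw [mul_comm f y]
    · rintro ⟨y, hy⟩
      obtain ⟨y, rfl⟩ := Ideal.Quotient.mk_surjective y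
      rw [← hy]
      exact (Submodule.Quotient.mk_eq_zero _).2
        (Ideal.mul_mem_right _ _ (Ideal.mem_span_singleton_self f))

lemma length_quotient_le_of_le {C : Type*} [CommRing C] {B : Type*} [CommRing B] [Algebra C B]
    {D D' : Ideal B} (h : D ≤ D') : Module.length C (B ⧸ D') ≤ Module.length C (B ⧸ D) := by
  refine Module.length_le_of_surjective ((Submodule.factor h).restrictScalars C) fun x => ?_
  obtain ⟨x, rfl⟩ := Ideal.Quotient.mk_surjective x
  exact ⟨Ideal.Quotient.mk _ x, rfl⟩

/-- The number of generators of `I` is the colength of `𝔪 I` in `I`. -/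
lemma length_quotient_maximalIdeal_mul [IsLocalRing C] [IsNoetherianRing C] (I : Ideal C) :
    Module.length C (C ⧸ maximalIdeal C * I) = Submodule.spanFinrank I + Module.length C (C ⧸ I) := by
  have h : maximalIdeal C * I ≤ I := Ideal.mul_le_right
  have h' : (maximalIdeal C • ⊤ : Submodule C I) ≤ Submodule.comap I.subtype (maximalIdeal C * I) := by
    rw [Submodule.smul_le]
    rintro a ha ⟨x, hx⟩ -
    exact Ideal.mul_mem_mul ha hx
  rw [Module.length_eq_add_of_exact (Submodule.mapQ _ (maximalIdeal C * I) I.subtype h')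
    (Submodule.factor h)]
  · congr 1
    let : Module (ResidueField C) (I ⧸ maximalIdeal C • (⊤ : Submodule C I)) :=
      inferInstanceAs (Module (C ⧸ maximalIdeal C) _)
    let : IsScalarTower C (ResidueField C) (I ⧸ maximalIdeal C • (⊤ : Submodule C I)) :=
      inferInstanceAs (IsScalarTower C (C ⧸ maximalIdeal C) _)
    have : Module.Finite (ResidueField C) (I ⧸ maximalIdeal C • (⊤ : Submodule C I)) :=
      Module.Finite.of_restrictScalars_finite C _ _
    rw [Module.length_eq_of_surjective (R := ResidueField C) (S := C) residue_surjective,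
      Module.length_eq_finrank, IsLocalRing.spanFinrank_eq_finrank_quotient I
      I.fg_of_isNoetherianRing]
    rfl
  · rw [injective_iff_map_eq_zero]
    intro x hx
    obtain ⟨⟨x, hxI⟩, rfl⟩ := Submodule.Quotient.mk_surjective _ x
    have hx' : x ∈ maximalIdeal C * I := (Submodule.Quotient.mk_eq_zero _).1 hx
    rw [Submodule.Quotient.mk_eq_zero]
    refine Submodule.mul_induction_on' (C := fun z hz => (⟨z, h hz⟩ : I) ∈
      (maximalIdeal C • ⊤ : Submodule C I)) ?_ ?_ hx'
    · intro a ha b hb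
      exact Submodule.smul_mem_smul (N := (⊤ : Submodule C I)) (n := ⟨b, hb⟩) ha trivial
    · intro a ha b hb h h'
      exact Submodule.add_mem _ h h'
  · intro x
    obtain ⟨x, rfl⟩ := Ideal.Quotient.mk_surjective x
    exact ⟨Ideal.Quotient.mk _ x, rfl⟩
  · intro x
    obtain ⟨x, rfl⟩ := Ideal.Quotient.mk_surjective x
    constructor
    · intro hx
      have hx' : x ∈ I := (Submodule.Quotient.mk_eq_zero _).1 hx
      exact ⟨Submodule.Quotient.mk ⟨x, hx'⟩, rfl⟩
    · rintro ⟨y, hy⟩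
      obtain ⟨⟨y, hyI⟩, rfl⟩ := Submodule.Quotient.mk_surjective _ y
      rw [← hy]
      exact (Submodule.Quotient.mk_eq_zero _).2 hyI

/-- A regular element `f` of `𝔪 B`, for a finite free extension `B` of rank `d`, with `B / f B` of
length at most `d e` bounds the numbers of generators of ideals of finite colength. -/
lemma spanFinrank_le_of_length_le [IsLocalRing C] [IsNoetherianRing C] [Nontrivial B]
    [Module.Free C B]
    [Module.Finite C B] {f : B} (hf : f ∈ nonZeroDivisors B)
    (hfm : f ∈ (maximalIdeal C).map (algebraMap C B)) {e : ℕ}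
    (he : Module.length C (B ⧸ Ideal.span {f}) ≤ Module.finrank C B * e) (I : Ideal C)
    (hI : Module.length C (C ⧸ I) ≠ ⊤) : Submodule.spanFinrank I ≤ e := by
  have h₁ : Ideal.span {f} * I.map (algebraMap C B) ≤ (maximalIdeal C * I).map (algebraMap C B) := by
    rw [Ideal.map_mul]
    exact Ideal.mul_mono_left ((Ideal.span_singleton_le_iff_mem _).2 hfm)
  -- With d the rank, λ the colength of `I` and ν its number of generators, fIB ⊆ 𝔪IB gives d(ν + λ)
  -- ≤ dλ + de. Here λ is finite, so it cancels.
  have h₂ := length_quotient_le_of_le (C := C) h₁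
  rw [length_quotient_span_mul C hf, length_quotient_map, length_quotient_map,
    length_quotient_maximalIdeal_mul] at h₂
  have h₃ := h₂.trans (add_le_add_right he _)
  obtain ⟨l, hl⟩ := ENat.ne_top_iff_exists.1 hI
  rw [← hl] at h₃
  norm_cast at h₃
  have hpos : 0 < Module.finrank C B := (Module.finrank_pos_iff_of_free C B).2 inferInstance
  rw [← mul_add] at h₃
  have := Nat.le_of_mul_le_mul_left h₃ hpos
  omega

end length

/-! ### Multiplicity bounds the number of generators -/

section multiplicity

lemma nontrivial_adjoinRoot {C : Type*} [CommRing C] [Nontrivial C] {g : C[X]} (hg : g.Monic)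
    (hd : g.natDegree ≠ 0) : Nontrivial (AdjoinRoot g) := by
  refine nontrivial_of_ne 1 0 fun h => ?_
  rw [← map_one (AdjoinRoot.mk g), AdjoinRoot.mk_eq_zero] at h
  exact hg.not_dvd_of_natDegree_lt one_ne_zero (by simpa [Nat.pos_iff_ne_zero] using hd) h

lemma krullDimLE_one_of_ringKrullDim_eq {C : Type*} [CommRing C] (hdim : ringKrullDim C = 1) :
    Ring.KrullDimLE 1 C :=
  Ring.krullDimLE_iff.2 (by rw [hdim]; rfl)

lemma exists_finset_of_spanFinrank_le {C : Type*} [CommRing C] [IsNoetherianRing C] {I : Ideal C}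
    {n : ℕ} (h : Submodule.spanFinrank I ≤ n) :
    ∃ Y : Finset I, Y.card ≤ n ∧ Submodule.span C (Y : Set I) = ⊤ := by
  obtain ⟨Y, hY, hY'⟩ :=
    (IsNoetherian.noetherian (⊤ : Submodule C I)).exists_span_finset_card_eq_spanFinrank
  exact ⟨Y, by rwa [hY, Submodule.spanFinrank_top], hY'⟩

variable {C : Type*} [CommRing C] [IsLocalRing C]

/-- The colengths of the powers of 𝔪 are eventually linear of slope `e`. The set whose infimum
defines `mult` is then the singleton {e}. -/
lemma mult_eq_of_length_succ (hdim : ringKrullDim C = 1) {n e : ℕ} {l : ℕ → ℕ}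
    (hl : ∀ j, Module.length C (C ⧸ maximalIdeal C ^ j) = l j)
    (h : ∀ j, n ≤ j → l (j + 1) = l j + e) : mult C (maximalIdeal C) = e := by
  have hd : ((ringKrullDim C).unbotD 0).toNat = 1 := by rw [hdim]; rfl
  have hlin (i : ℕ) : l (n + i) = l n + i * e := by
    induction i with
    | zero => simp
    | succ i ih => rw [← add_assoc, h _ (Nat.le_add_right n i), ih]; ring
  have ht : Filter.Tendsto (fun j : ℕ => (l j : ℝ) / (j : ℝ)) Filter.atTop (nhds (e : ℝ)) := by
    have h1 : Filter.Tendsto (fun j : ℕ => (e : ℝ) + ((l n : ℝ) - n * e) / (j : ℝ)) Filter.atTop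
        (nhds ((e : ℝ) + 0)) :=
      tendsto_const_nhds.add (tendsto_const_div_atTop_nhds_zero_nat _)
    rw [add_zero] at h1
    refine h1.congr' ?_
    filter_upwards [Filter.eventually_ge_atTop (n + 1)] with j hj
    obtain ⟨i, rfl⟩ := Nat.exists_eq_add_of_le (Nat.le_of_succ_le hj)
    have hpos : ((n + i : ℕ) : ℝ) ≠ 0 := by
      have : 0 < n + i := by omega
      positivity
    rw [hlin]
    field_simp
    push_cast
    ring
  have hset : {e' : ℕ | Filter.Tendsto (fun j : ℕ => ((1 : ℕ).factorial : ℝ) *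
      ((Module.length C (C ⧸ maximalIdeal C ^ j)).toNat : ℝ) / (j : ℝ) ^ 1) Filter.atTop
      (nhds (e' : ℝ))} = {e} := by
    ext e'
    simp only [hl, Nat.factorial_one, Nat.cast_one, one_mul, pow_one, ENat.toNat_natCast,
      Set.mem_ofPred_eq, Set.mem_singleton_iff]
    refine ⟨fun he' => ?_, fun he' => he' ▸ ht⟩
    exact_mod_cast tendsto_nhds_unique he' ht
  unfold mult
  simp only [hd]
  rw [hset, csInf_singleton]

/-- An element annihilated by `f` is annihilated by 𝔪ⁿ, so its coordinates in a basis lie in H⁰_𝔪(C)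
= 0. -/
lemma mem_nonZeroDivisors_of_pow_le {B : Type*} [CommRing B] [Algebra C B] [Module.Free C B]
    (hH : H0 (maximalIdeal C) C = ⊥) {f : B} {n : ℕ}
    (hf : (maximalIdeal C ^ n).map (algebraMap C B) ≤ Ideal.span {f}) : f ∈ nonZeroDivisors B := by
  rw [mem_nonZeroDivisors_iff_right]
  intro z hz
  let b := Module.Free.chooseBasis C B
  refine b.repr.map_eq_zero_iff.1 (Finsupp.ext fun i => ?_)
  have : b.repr z i ∈ H0 (maximalIdeal C) C := by
    refine ⟨n, fun a ha => ?_⟩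
    obtain ⟨c, hc⟩ := Ideal.mem_span_singleton'.1 (hf (Ideal.mem_map_of_mem _ ha))
    have : a • z = 0 := by
      rw [Algebra.smul_def, ← hc, mul_assoc, mul_comm f, hz, mul_zero]
    rw [← Finsupp.smul_apply, ← map_smul, this, map_zero, Finsupp.zero_apply]
  rwa [hH] at this

variable [IsNoetherianRing C]

/-- If 𝔪 consisted of zero divisors, it would annihilate a nonzero element, which would lie in
H⁰_𝔪(C). -/
lemma exists_mem_maximalIdeal_nonZeroDivisors (hH : H0 (maximalIdeal C) C = ⊥) :
    ∃ y ∈ maximalIdeal C, y ∈ nonZeroDivisors C := by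
  by_contra! hcon
  have := Ideal.bot_lt_annihilator_of_disjoint_nonZeroDivisors
    (I := maximalIdeal C) (Set.disjoint_left.2 hcon)
  obtain ⟨x, hx, hx0⟩ := SetLike.exists_of_lt this
  refine hx0 ?_
  have hxH : x ∈ H0 (maximalIdeal C) C := ⟨1, fun a ha => by
    rw [pow_one] at ha
    rw [smul_eq_mul, mul_comm]
    exact congrArg Subtype.val (Module.mem_annihilator.1 hx ⟨a, ha⟩)⟩
  rwa [hH] at hxH

lemma length_quotient_ne_top (hdim : ringKrullDim C = 1) (hH : H0 (maximalIdeal C) C = ⊥)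
    {I : Ideal C} {k : ℕ} (hk : maximalIdeal C ^ k ≤ I) : Module.length C (C ⧸ I) ≠ ⊤ := by
  have := krullDimLE_one_of_ringKrullDim_eq hdim
  obtain ⟨y, hy, hreg⟩ := exists_mem_maximalIdeal_nonZeroDivisors hH
  have hfin := isFiniteLength_quotient_span_singleton C (pow_mem hreg k)
  refine ne_top_of_le_ne_top (Module.length_ne_top_iff.2 hfin) (length_quotient_le_of_le ?_)
  rw [Ideal.span_singleton_le_iff_mem]
  exact hk (Ideal.pow_mem_pow hy k)

/-- The multiplicity of a one-dimensional Cohen-Macaulay local ring bounds the numbers of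
generators of ideals of finite colength. -/
theorem spanFinrank_le_mult (hdim : ringKrullDim C = 1) (hH : H0 (maximalIdeal C) C = ⊥) :
    1 ≤ mult C (maximalIdeal C) ∧ ∀ I : Ideal C, Module.length C (C ⧸ I) ≠ ⊤ →
      Submodule.spanFinrank I ≤ mult C (maximalIdeal C) := by
  have := krullDimLE_one_of_ringKrullDim_eq hdim
  obtain ⟨y, hy, hreg⟩ := exists_mem_maximalIdeal_nonZeroDivisors hH
  obtain ⟨n, hn⟩ := ENat.ne_top_iff_exists.1
    (Module.length_ne_top_iff.2 (isFiniteLength_quotient_span_singleton C hreg))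
  have hfin (j : ℕ) := length_quotient_ne_top hdim hH (le_refl (maximalIdeal C ^ j))
  choose l hl using fun j => ENat.ne_top_iff_exists.1 (hfin j)
  -- A crude bound, from the regular element `y` and the trivial extension: powers of 𝔪 need at most
  -- `n` = length(C/y) generators. This suffices to apply Eakin–Sathaye to 𝔪^(n+1).
  have hbd : Submodule.spanFinrank (maximalIdeal C ^ (n + 1)) ≤ n + 1 :=
    (spanFinrank_le_of_length_le hreg (by simpa using hy) (by simp [← hn]) _ (hfin _)).trans
      (Nat.le_succ n)
  obtain ⟨Y, hYc, hY⟩ := exists_finset_of_spanFinrank_le hbd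
  obtain ⟨g, hg, hgd, f, hf, hle⟩ := exists_adjoinRoot_reduction (maximalIdeal C) ⊥ Y
    (by rw [hY, top_sup_eq]) hYc
  rw [Ideal.map_bot, sup_bot_eq] at hle
  let B := AdjoinRoot g
  have : Module.Finite C B := hg.finite_adjoinRoot
  have : Module.Free C B := hg.free_adjoinRoot
  have : Nontrivial B := nontrivial_adjoinRoot hg hgd
  have hfreg : f ∈ nonZeroDivisors B :=
    mem_nonZeroDivisors_of_pow_le hH (hle.trans Ideal.mul_le_left)
  have heq (j : ℕ) (hj : n ≤ j) : Ideal.span {f} * (maximalIdeal C ^ j).map (algebraMap C B) =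
      (maximalIdeal C ^ (j + 1)).map (algebraMap C B) := by
    refine le_antisymm ?_ ?_
    · rw [pow_succ', Ideal.map_mul]
      exact Ideal.mul_mono_left ((Ideal.span_singleton_le_iff_mem _).2 hf)
    · obtain ⟨i, rfl⟩ := Nat.exists_eq_add_of_le hj
      rw [show n + i + 1 = (n + 1) + i by omega, pow_add _ (n + 1), pow_add _ n i, Ideal.map_mul,
        Ideal.map_mul, ← mul_assoc]
      exact Ideal.mul_mono_left hle
  have hpos : 0 < Module.finrank C B := (Module.finrank_pos_iff_of_free C B).2 inferInstance
  -- For j ≥ n the colengths of the powers of 𝔪 grow by the constant length(B/fB)/rank(B), which is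
  -- therefore the multiplicity. Thus `f` itself gives the sharp bound on generators.
  have hlen (j : ℕ) (hj : n ≤ j) : (Module.finrank C B : ℕ∞) * l (j + 1) =
      Module.finrank C B * l j + Module.length C (B ⧸ Ideal.span {f}) := by
    rw [hl, hl, ← length_quotient_map, ← length_quotient_map, ← heq j hj,
      length_quotient_span_mul C hfreg]
  obtain ⟨ε, hε⟩ : ∃ ε : ℕ, (ε : ℕ∞) = Module.length C (B ⧸ Ideal.span {f}) := by
    refine ENat.ne_top_iff_exists.1 fun h => ?_
    have := hlen n le_rfl
    rw [h, add_top] at this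
    exact absurd this (by exact_mod_cast ENat.natCast_ne_top _)
  rw [← hε] at hlen
  norm_cast at hlen
  obtain ⟨e, he⟩ : ∃ e, l (n + 1) = l n + e :=
    Nat.exists_eq_add_of_le (Nat.le_of_mul_le_mul_left (by rw [hlen n le_rfl]; omega) hpos)
  have hεe : ε = Module.finrank C B * e := by
    have := hlen n le_rfl
    rw [he, mul_add] at this
    omega
  have hsucc (j : ℕ) (hj : n ≤ j) : l (j + 1) = l j + e := by
    have := hlen j hj
    rw [hεe, ← mul_add] at this
    exact Nat.eq_of_mul_eq_mul_left hpos this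
  rw [mult_eq_of_length_succ hdim (fun j => (hl j).symm) hsucc]
  have key (I : Ideal C) (hI : Module.length C (C ⧸ I) ≠ ⊤) : Submodule.spanFinrank I ≤ e :=
    spanFinrank_le_of_length_le hfreg hf (by rw [← hε, hεe]; push_cast; rfl) I hI
  refine ⟨?_, key⟩
  by_contra h0
  have h1 := key (maximalIdeal C) (by have := hfin 1; rwa [pow_one] at this)
  have h2 : maximalIdeal C = ⊥ :=
    (Submodule.spanFinrank_eq_zero_iff_eq_bot (maximalIdeal C).fg_of_isNoetherianRing).1 (by omega)
  rw [h2] at hy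
  rw [(Submodule.mem_bot C).1 hy] at hreg
  exact zero_notMem_nonZeroDivisors hreg

end multiplicity

/-! ### Minimal components and the invariants entering `brt` -/

section components

variable {R : Type*} [CommRing R]

lemma mem_minimalPrimes_of_ne [IsLocalRing R] [Ring.KrullDimLE 1 R] {p : Ideal R} (hp : p.IsPrime)
    (hpm : p ≠ maximalIdeal R) : p ∈ minimalPrimes R :=
  (Ring.krullDimLE_one_iff.1 ‹_› p hp).resolve_right fun h => hpm (eq_maximalIdeal h)

lemma radical_mem_minimalPrimes {q : Ideal R} (hq : q ∈ minimalComponents R) :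
    q.radical ∈ minimalPrimes R := by
  obtain ⟨t, -, -, h⟩ := hq
  exact h

lemma nilIndex_le_of_brt_le {𝔪 : Ideal R} {n : ℕ} (h : brt R 𝔪 ≤ n) : nilIndex R ≤ n := by
  exact_mod_cast (le_max_left _ _).trans h

variable [IsNoetherianRing R]

/-- An element which vanishes at all primes other than `𝔪` belongs to `H⁰_𝔪`. -/
lemma mem_H0_of_forall_prime [IsLocalRing R] {M : Type*} [AddCommGroup M] [Module R M] {z : M}
    (h : ∀ p : Ideal R, p.IsPrime → p ≠ maximalIdeal R → ∃ s ∉ p, s • z = 0) :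
    z ∈ H0 (maximalIdeal R) M := by
  have hle : maximalIdeal R ≤ (Ideal.torsionOf R M z).radical := by
    rw [Ideal.radical_eq_sInf]
    refine le_sInf fun p ⟨hp, hpr⟩ => ?_
    by_cases hpm : p = maximalIdeal R
    · exact hpm.ge
    · obtain ⟨s, hs, hsz⟩ := h p hpr hpm
      exact absurd (hp hsz) hs
  obtain ⟨n, hn⟩ := Ideal.exists_pow_le_of_le_radical_of_fg hle (maximalIdeal R).fg_of_isNoetherianRing
  exact ⟨n, fun a ha => hn ha⟩

lemma exists_prime_ne_maximalIdeal [IsLocalRing R] (hH : H0 (maximalIdeal R) R = ⊥) :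
    ∃ p : Ideal R, p.IsPrime ∧ p ≠ maximalIdeal R := by
  by_contra! hcon
  have : (1 : R) ∈ H0 (maximalIdeal R) R :=
    mem_H0_of_forall_prime fun p hp hpm => absurd (hcon p hp) hpm
  rw [hH] at this
  exact one_ne_zero this

lemma ne_maximalIdeal_of_mem_minimalPrimes [IsLocalRing R] (hH : H0 (maximalIdeal R) R = ⊥)
    {p : Ideal R} (hp : p ∈ minimalPrimes R) : p ≠ maximalIdeal R := by
  rintro rfl
  obtain ⟨p', hp', hne⟩ := exists_prime_ne_maximalIdeal hH
  exact hne (le_antisymm (le_maximalIdeal hp'.ne_top) (hp.2 ⟨hp', bot_le⟩ (le_maximalIdeal hp'.ne_top)))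

/-- In dimension zero 𝔪 would be the only prime, and no prime other than 𝔪 contradicts H⁰_𝔪(R) = 0.
-/
lemma ringKrullDim_eq_one [IsLocalRing R] [h1 : Ring.KrullDimLE 1 R]
    (hH : H0 (maximalIdeal R) R = ⊥) : ringKrullDim R = 1 := by
  refine le_antisymm (Ring.krullDimLE_iff.1 h1) ?_
  by_contra hlt
  have h0 : Ring.KrullDimLE 0 R := by
    rw [Ring.krullDimLE_iff]
    rw [not_le, show (1 : WithBot ℕ∞) = ((0 : ℕ) : WithBot ℕ∞) + 1 by simp,
      ENat.WithBot.lt_add_one_iff] at hlt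
    exact hlt
  obtain ⟨p, hp, hne⟩ := exists_prime_ne_maximalIdeal hH
  exact hne (eq_maximalIdeal (Ring.krullDimLE_zero_iff.1 h0 p hp))

lemma exists_mem_minimalComponents {p : Ideal R} (hp : p ∈ minimalPrimes R) :
    ∃ q ∈ minimalComponents R, q.radical = p := by
  obtain ⟨t, ht⟩ := Submodule.IsLasker.exists_isMinimalPrimaryDecomposition
    (Submodule.isLasker R R) (⊥ : Ideal R)
  obtain ⟨q, hq, rfl⟩ := Ideal.IsMinimalPrimaryDecomposition.minimalPrimes_subset_image_radical ht hp
  exact ⟨q, ⟨t, ht, hq, hp⟩, rfl⟩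

/-- A one-dimensional Cohen-Macaulay local ring has no embedded components. -/
lemma eq_zero_of_forall_mem_minimalComponents [IsLocalRing R] [Ring.KrullDimLE 1 R]
    (hH : H0 (maximalIdeal R) R = ⊥) {z : R} (h : ∀ q ∈ minimalComponents R, z ∈ q) : z = 0 := by
  have : z ∈ H0 (maximalIdeal R) R := mem_H0_of_forall_prime fun p hp hpm => by
    obtain ⟨q, hq, rfl⟩ := exists_mem_minimalComponents (mem_minimalPrimes_of_ne hp hpm)
    exact (mem_minimalComponents_iff hq z).1 (h q hq)
  rwa [hH] at this

/-- Noetherianity makes the set of admissible exponents nonempty, so its infimum is attained and is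
not the default value 0. -/
lemma radical_pow_componentIndex_le (q : Ideal R) : q.radical ^ componentIndex q ≤ q := by
  obtain ⟨n, hn⟩ := q.exists_radical_pow_le_of_fg q.radical.fg_of_isNoetherianRing
  exact (Nat.sInf_mem (s := {n : ℕ | 1 ≤ n ∧ q.radical ^ n ≤ q})
    ⟨n + 1, Nat.le_add_left 1 n, (Ideal.pow_le_pow_right (Nat.le_succ n)).trans hn⟩).2

variable (R) in
lemma nilIndex_spec : 1 ≤ nilIndex R ∧ nilradical R ^ nilIndex R = ⊥ := by
  obtain ⟨n, hn⟩ := (⊥ : Ideal R).exists_radical_pow_le_of_fg (nilradical R).fg_of_isNoetherianRing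
  exact Nat.sInf_mem (s := {n : ℕ | 1 ≤ n ∧ nilradical R ^ n = ⊥})
    ⟨n + 1, Nat.le_add_left 1 n, le_bot_iff.1 ((Ideal.pow_le_pow_right (Nat.le_succ n)).trans hn)⟩

lemma exists_complIndex_eq {𝔪 : Ideal R} {n : ℕ} (h : brt R 𝔪 ≤ n) {S : Set (Ideal R)}
    (hS : S ⊆ minimalComponents R) (hne : S.Nonempty) :
    ∃ t : ℕ, mult (R ⧸ sInf S) (𝔪.map (Ideal.Quotient.mk (sInf S))) + t ≤ n ∧
      ∀ q ∈ minimalComponents R, q ∉ S → componentIndex q ≤ t := by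
  obtain ⟨t, ht⟩ := ENat.ne_top_iff_exists.1 (complIndex_ne_top S)
  refine ⟨t, ?_, fun q hq hqS => ?_⟩
  · have h1 := (le_iSup (fun S : {S : Set (Ideal R) // S ⊆ minimalComponents R ∧ S.Nonempty} =>
      (mult (R ⧸ sInf S.1) (𝔪.map (Ideal.Quotient.mk (sInf S.1))) : ℕ∞) + complIndex S.1)
      ⟨S, hS, hne⟩).trans ((le_max_right _ _).trans h)
    simp only [← ht] at h1
    exact_mod_cast h1
  · have h1 : (componentIndex q : ℕ∞) ≤ complIndex S :=
      le_iSup₂ (f := fun q (_ : q ∈ minimalComponents R \ S) => (componentIndex q : ℕ∞)) q ⟨hq, hqS⟩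
    rw [← ht] at h1
    exact_mod_cast h1

end components

/-! ### The quotient by an intersection of minimal components -/

section quotient

variable {R : Type*} [CommRing R] [IsNoetherianRing R] [IsLocalRing R]

/-- The primes of the components in `S` differ from 𝔪, so each misses an element of 𝔪, whose powers
can be cancelled modulo the primary component. -/
lemma H0_quotient_eq_bot (hH : H0 (maximalIdeal R) R = ⊥) {S : Set (Ideal R)}
    (hS : S ⊆ minimalComponents R) [IsLocalRing (R ⧸ sInf S)] :
    H0 (maximalIdeal (R ⧸ sInf S)) (R ⧸ sInf S) = ⊥ := by
  rw [eq_bot_iff]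
  rintro z ⟨k, hk⟩
  obtain ⟨z, rfl⟩ := Ideal.Quotient.mk_surjective z
  rw [Submodule.mem_bot, Ideal.Quotient.eq_zero_iff_mem, Ideal.mem_sInf]
  intro q hq
  have hne := ne_maximalIdeal_of_mem_minimalPrimes hH (radical_mem_minimalPrimes (hS hq))
  obtain ⟨t, ht, hqt, hmin⟩ := hS hq
  have hprime : q.radical.IsPrime := hmin.1.1
  obtain ⟨a, ha, haq⟩ := SetLike.exists_of_lt
    (lt_of_le_of_ne (le_maximalIdeal hprime.ne_top) hne)
  have hmap : (maximalIdeal R).map (Ideal.Quotient.mk (sInf S)) = maximalIdeal (R ⧸ sInf S) :=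
    map_maximalIdeal_of_surjective _ Ideal.Quotient.mk_surjective
  have h0 := hk (Ideal.Quotient.mk _ (a ^ k)) (by
    rw [← hmap, map_pow]
    exact Ideal.pow_mem_pow (Ideal.mem_map_of_mem _ ha) k)
  rw [smul_eq_mul, ← map_mul, Ideal.Quotient.eq_zero_iff_mem, mul_comm] at h0
  refine ((Ideal.isPrimary_iff.1 (ht.primary hqt)).2 (sInf_le hq h0)).resolve_right fun h => ?_
  exact haq (hprime.mem_of_pow_mem k h)

/-- A prime other than 𝔪 that contains the intersection of `S` is the radical of some member of `S`,
hence does not contain `I`. Only 𝔪 can contain `I ⊔ sInf S`. -/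
lemma exists_pow_le_sup_sInf [Ring.KrullDimLE 1 R] {I : Ideal R} {S : Set (Ideal R)}
    (hS : S ⊆ minimalComponents R) (hI : ∀ q ∈ S, ¬ I ≤ q.radical) :
    ∃ k, maximalIdeal R ^ k ≤ I ⊔ sInf S := by
  refine Ideal.exists_pow_le_of_le_radical_of_fg ?_ (maximalIdeal R).fg_of_isNoetherianRing
  rw [Ideal.radical_eq_sInf]
  refine le_sInf fun p ⟨hp, hpr⟩ => ?_
  by_cases hpm : p = maximalIdeal R
  · exact hpm.ge
  have hfin : S.Finite := finite_minimalComponents.subset hS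
  have hle : hfin.toFinset.inf id ≤ p := by
    rw [Finset.inf_id_eq_sInf, hfin.coe_toFinset]
    exact le_sup_right.trans hp
  obtain ⟨q, hq, hqp⟩ := (Ideal.IsPrime.inf_le' hpr).1 hle
  rw [Set.Finite.mem_toFinset] at hq
  have h1 : q.radical ≤ p := hpr.radical_le_iff.2 hqp
  have h2 : q.radical = p := le_antisymm h1
    ((mem_minimalPrimes_of_ne hpr hpm).2 ⟨(radical_mem_minimalPrimes (hS hq)).1.1, bot_le⟩ h1)
  exact absurd (le_sup_left.trans hp) (h2 ▸ hI q hq)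

end quotient

/-! ### Lifting generators -/

section lifting

variable {A C : Type*} [CommRing A] [CommRing C] [Algebra A C]

/-- Generators of the image of an ideal lift along a surjection. -/
lemma exists_finset_lift (hsurj : Function.Surjective (algebraMap A C)) (I : Ideal A)
    (Y : Finset (I.map (algebraMap A C)))
    (hY : Submodule.span C (Y : Set (I.map (algebraMap A C))) = ⊤) :
    ∃ Y' : Finset I, Y'.card ≤ Y.card ∧ Submodule.span A (Y' : Set I) ⊔
      Submodule.comap (Submodule.subtype I) (RingHom.ker (algebraMap A C)) = ⊤ := by
  classical
  let π : I →ₗ[A] I.map (algebraMap A C) :=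
    { toFun := fun z => ⟨algebraMap A C z.1, Ideal.mem_map_of_mem _ z.2⟩
      map_add' := fun z w => by ext1; simp
      map_smul' := fun a z => by
        ext1
        change algebraMap A C (a * z.1) = a • algebraMap A C z.1
        rw [map_mul, Algebra.smul_def] }
  have hπ : Function.Surjective π := by
    rintro ⟨w, hw⟩
    obtain ⟨z, hz, rfl⟩ := (Ideal.mem_map_iff_of_surjective _ hsurj).1 hw
    exact ⟨⟨z, hz⟩, rfl⟩
  have hker : LinearMap.ker π =
      Submodule.comap (Submodule.subtype I) (RingHom.ker (algebraMap A C)) := by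
    ext z
    simp [π, LinearMap.mem_ker, RingHom.mem_ker]
  refine ⟨Y.image (Function.surjInv hπ), Finset.card_image_le, ?_⟩
  rw [← hker, ← LinearMap.map_eq_top_iff (LinearMap.range_eq_top.2 hπ), Submodule.map_span,
    Finset.coe_image, ← Set.image_comp, (Function.rightInverse_surjInv hπ).comp_eq_id, Set.image_id,
    ← Submodule.restrictScalars_span A C hsurj, hY, Submodule.restrictScalars_top]

end lifting

/-! ### Reductions with exponent controlled by `brt` -/

section reduction

variable {A : Type*} [CommRing A]

/-- After a finite free extension `B = A[X]/(g)` of `A`, there is `f ∈ I B` with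
`I ^ (n + 1) B ⊆ f I ^ n B + J B`. -/
def HasReduction (I J : Ideal A) (n : ℕ) : Prop :=
  ∃ g : A[X], g.Monic ∧ g.natDegree ≠ 0 ∧ ∃ f ∈ I.map (algebraMap A (AdjoinRoot g)),
    (I ^ (n + 1)).map (algebraMap A (AdjoinRoot g)) ≤
      Ideal.span {f} * (I ^ n).map (algebraMap A (AdjoinRoot g)) ⊔
        J.map (algebraMap A (AdjoinRoot g))

lemma hasReduction_of_pow_le [Nontrivial A] {I J : Ideal A} {n : ℕ} (h : I ^ (n + 1) ≤ J) :
    HasReduction I J n :=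
  ⟨Polynomial.X, Polynomial.monic_X, by simp, 0, Ideal.zero_mem _,
    (Ideal.map_mono h).trans le_sup_right⟩

/-- Multiplying a reduction modulo `L` by a power of `I` which sends `L` into `J`. -/
lemma HasReduction.of_pow_mul_le {I J L : Ideal A} {n k : ℕ} (h : HasReduction I L n)
    (hk : I ^ k * L ≤ J) : HasReduction I J (n + k) := by
  obtain ⟨g, hg, hd, f, hf, hle⟩ := h
  refine ⟨g, hg, hd, f, hf, ?_⟩
  rw [show n + k + 1 = (n + 1) + k by omega, pow_add _ (n + 1), pow_add _ n k, Ideal.map_mul,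
    Ideal.map_mul, ← mul_assoc]
  refine (Ideal.mul_mono_left hle).trans ?_
  rw [Ideal.sup_mul]
  refine sup_le_sup le_rfl ?_
  rw [← Ideal.map_mul, mul_comm]
  exact Ideal.map_mono hk

variable [IsLocalRing A] [IsNoetherianRing A] {R : Type*} [CommRing R] [IsLocalRing R]
  [IsNoetherianRing R] [Ring.KrullDimLE 1 R] [Algebra A R]

/-- In `R ⧸ sInf S` the ideal `I` has finite colength, so Eakin–Sathaye applies with e generators
and gives a reduction modulo the kernel of `A → R ⧸ sInf S`. That kernel times I^t maps into every
minimal component of `R`, hence to 0, since `R` has no embedded component. -/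
lemma hasReduction_of_mult_add_le (hsurj : Function.Surjective (algebraMap A R))
    (hH : H0 (maximalIdeal R) R = ⊥) (I : Ideal A) {S : Set (Ideal R)} (hne : S.Nonempty)
    (hS : S ⊆ minimalComponents R) (hIS : ∀ q ∈ S, ¬ I.map (algebraMap A R) ≤ q.radical)
    {n t : ℕ}
    (hmult : mult (R ⧸ sInf S) ((maximalIdeal R).map (Ideal.Quotient.mk (sInf S))) + t ≤ n + 1)
    (ht : ∀ q ∈ minimalComponents R, q ∉ S → I.map (algebraMap A R) ≤ q.radical ∧
      componentIndex q ≤ t) :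
    HasReduction I (RingHom.ker (algebraMap A R)) n := by
  let C := R ⧸ sInf S
  obtain ⟨q₀, hq₀⟩ := hne
  have hnt : Nontrivial C := by
    refine Ideal.Quotient.nontrivial_iff.2 fun h => ?_
    have h1 : q₀.radical = ⊤ := top_le_iff.1 (h ▸ (sInf_le hq₀).trans Ideal.le_radical)
    exact (radical_mem_minimalPrimes (hS hq₀)).1.1.ne_top h1
  have hloc : IsLocalRing C :=
    IsLocalRing.of_surjective' (Ideal.Quotient.mk (sInf S)) Ideal.Quotient.mk_surjective
  have hmax : (maximalIdeal R).map (Ideal.Quotient.mk (sInf S)) = maximalIdeal C :=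
    map_maximalIdeal_of_surjective _ Ideal.Quotient.mk_surjective
  have hHC : H0 (maximalIdeal C) C = ⊥ := H0_quotient_eq_bot hH hS
  have hC1 : Ring.KrullDimLE 1 C := by
    rw [Ring.krullDimLE_iff]
    exact (ringKrullDim_quotient_le _).trans (Ring.krullDimLE_iff.1 ‹_›)
  have hCdim := ringKrullDim_eq_one hHC
  obtain ⟨he1, he⟩ := spanFinrank_le_mult hCdim hHC
  rw [hmax] at hmult
  set e := mult C (maximalIdeal C) with hedef
  -- Eakin–Sathaye wants at most m + 1 generators of `I ^ (m + 1)`, so m = e − 1. The hypothesis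
  -- `hmult` then leaves n − m ≥ t factors of `I`.
  obtain ⟨m, hm⟩ : ∃ m, e = m + 1 := ⟨e - 1, by omega⟩
  have hCsurj : Function.Surjective (algebraMap A C) := by
    rw [IsScalarTower.algebraMap_eq A R C]
    exact Ideal.Quotient.mk_surjective.comp hsurj
  obtain ⟨k, hk⟩ := exists_pow_le_sup_sInf hS hIS
  have hkC : maximalIdeal C ^ k ≤ I.map (algebraMap A C) := by
    have := Ideal.map_mono (f := Ideal.Quotient.mk (sInf S)) hk
    rwa [Ideal.map_sup, Ideal.map_quotient_self, sup_bot_eq, Ideal.map_pow, hmax, Ideal.map_map] at this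
  have hlen : Module.length C (C ⧸ (I ^ (m + 1)).map (algebraMap A C)) ≠ ⊤ := by
    refine length_quotient_ne_top hCdim hHC (k := k * (m + 1)) ?_
    rw [pow_mul, Ideal.map_pow]
    exact Ideal.pow_right_mono hkC _
  obtain ⟨Y, hYc, hY⟩ := exists_finset_of_spanFinrank_le (he _ hlen)
  obtain ⟨Y', hYc', hY'⟩ := exists_finset_lift hCsurj _ Y hY
  have hred : HasReduction I (RingHom.ker (algebraMap A C)) m :=
    exists_adjoinRoot_reduction I _ Y' hY' (by omega)
  have hmn : n = m + (n - m) := by omega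
  rw [hmn]
  refine hred.of_pow_mul_le ?_
  rw [Ideal.mul_le]
  intro a ha l hl
  rw [RingHom.mem_ker]
  refine eq_zero_of_forall_mem_minimalComponents hH fun q hq => ?_
  rw [map_mul]
  by_cases hqS : q ∈ S
  · refine Ideal.mul_mem_left _ _ (sInf_le hqS ?_)
    rw [← Ideal.Quotient.eq_zero_iff_mem]
    exact hl
  · obtain ⟨hIq, hqt⟩ := ht q hq hqS
    refine Ideal.mul_mem_right _ _ (radical_pow_componentIndex_le q
      (Ideal.pow_le_pow_right (show componentIndex q ≤ n - m by omega) ?_))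
    refine Ideal.pow_right_mono hIq _ ?_
    rw [← Ideal.map_pow]
    exact Ideal.mem_map_of_mem _ ha

/-- The second conclusion is what later makes `f` regular modulo H⁰: away from 𝔪, either `I` is
locally the unit ideal or `I ^ (n + 1)` is locally inside the kernel. -/
theorem hasReduction_of_brt_le (hsurj : Function.Surjective (algebraMap A R))
    (hH : H0 (maximalIdeal R) R = ⊥) (I : Ideal A) {n : ℕ}
    (hn : brt R (maximalIdeal R) ≤ (n + 1 : ℕ)) :
    HasReduction I (RingHom.ker (algebraMap A R)) n ∧
      ∀ p : Ideal A, p.IsPrime → p ≠ maximalIdeal A →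
        ¬ I ≤ p ∨ ∀ a ∈ I ^ (n + 1), ∃ s ∉ p, s * a ∈ RingHom.ker (algebraMap A R) := by
  let S : Set (Ideal R) := {q | q ∈ minimalComponents R ∧ ¬ I.map (algebraMap A R) ≤ q.radical}
  have hS : S ⊆ minimalComponents R := fun q hq => hq.1
  rcases S.eq_empty_or_nonempty with hemp | hne
  · have hle : I ^ (n + 1) ≤ RingHom.ker (algebraMap A R) := by
      have h1 : I.map (algebraMap A R) ≤ nilradical R := by
        rw [nilradical_eq_sInf]
        refine le_sInf fun p hp => ?_
        have hp' : p.IsPrime := hp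
        obtain ⟨p₀, hp₀, hle⟩ := Ideal.exists_minimalPrimes_le (I := (⊥ : Ideal R)) (J := p) bot_le
        obtain ⟨q, hq, rfl⟩ := exists_mem_minimalComponents hp₀
        refine le_trans ?_ hle
        by_contra hnot
        exact (hemp ▸ (show q ∈ S from ⟨hq, hnot⟩) : q ∈ (∅ : Set (Ideal R)))
      intro a ha
      have h2 : algebraMap A R a ∈ nilradical R ^ nilIndex R := by
        refine Ideal.pow_le_pow_right (nilIndex_le_of_brt_le hn) (Ideal.pow_right_mono h1 _ ?_)
        rw [← Ideal.map_pow]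
        exact Ideal.mem_map_of_mem _ ha
      rwa [(nilIndex_spec R).2] at h2
    exact ⟨hasReduction_of_pow_le hle, fun p hp _ => Or.inr fun a ha =>
      ⟨1, fun h => hp.ne_top (Ideal.eq_top_of_isUnit_mem _ h isUnit_one),
        by rw [one_mul]; exact hle ha⟩⟩
  · obtain ⟨t, ht, hcomp⟩ := exists_complIndex_eq hn hS hne
    have hcompl (q : Ideal R) (hq : q ∈ minimalComponents R) (hqS : q ∉ S) :
        I.map (algebraMap A R) ≤ q.radical ∧ componentIndex q ≤ t :=
      ⟨not_not.1 fun h => hqS ⟨hq, h⟩, hcomp q hq hqS⟩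
    refine ⟨hasReduction_of_mult_add_le hsurj hH I hne hS (fun q hq => hq.2) ht hcompl,
      fun p hp hpm => ?_⟩
    rw [or_iff_not_imp_left, not_not]
    intro hIp a ha
    -- A prime p ≠ 𝔪 above the kernel comes from a minimal prime of `R`. Its component is the kernel
    -- of localisation there and contains the image of `I ^ (n + 1)`.
    by_cases hker : RingHom.ker (algebraMap A R) ≤ p
    · have hp' : (p.map (algebraMap A R)).IsPrime := Ideal.map_isPrime_of_surjective hsurj hker
      have hcm : (p.map (algebraMap A R)).comap (algebraMap A R) = p := by
        rw [Ideal.comap_map_of_surjective _ hsurj, ← RingHom.ker_eq_comap_bot, sup_eq_left]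
        exact hker
      have hpm' : p.map (algebraMap A R) ≠ maximalIdeal R := by
        intro h
        rw [h] at hcm
        have := IsLocalHom.of_surjective (algebraMap A R) hsurj
        rw [maximalIdeal_comap] at hcm
        exact hpm hcm.symm
      obtain ⟨q, hq, hqp⟩ := exists_mem_minimalComponents (mem_minimalPrimes_of_ne hp' hpm')
      have hqS : q ∉ S := fun h => h.2 (hqp ▸ Ideal.map_mono hIp)
      obtain ⟨h1, h2⟩ := hcompl q hq hqS
      have haq : algebraMap A R a ∈ q := by
        refine radical_pow_componentIndex_le q
          (Ideal.pow_le_pow_right (show componentIndex q ≤ n + 1 by omega)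
          (Ideal.pow_right_mono h1 _ ?_))
        rw [← Ideal.map_pow]
        exact Ideal.mem_map_of_mem _ ha
      obtain ⟨s, hs, hs0⟩ := (mem_minimalComponents_iff hq _).1 haq
      obtain ⟨s, rfl⟩ := hsurj s
      refine ⟨s, fun h => hs (hqp ▸ Ideal.mem_map_of_mem _ h), ?_⟩
      rwa [RingHom.mem_ker, map_mul]
    · obtain ⟨s, hs, hsp⟩ := SetLike.not_le_iff_exists.1 hker
      exact ⟨s, hsp, Ideal.mul_mem_right _ _ hs⟩

end reduction

/-! ### Relations tested by evaluation in `M` -/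

section evaluation

variable {A : Type*} [CommRing A] (I : Ideal A) (M : Type*) [AddCommGroup M] [Module A M]

/-- The morphism `S(I) → A` which sends `x ∈ I = S₁(I)` to `x`. -/
def symEval : SymmetricAlgebra A I →ₐ[A] A := SymmetricAlgebra.lift I.subtype

/-- The morphism `S(I) ⊗ M → M`, `s ⊗ m ↦ s m`. -/
def symTensorEval : SymmetricAlgebra A I ⊗[A] M →ₗ[A] M :=
  TensorProduct.lift ((LinearMap.lsmul A M) ∘ₗ (symEval I).toLinearMap)

@[simp]
lemma symEval_ι (x : I) : symEval I (SymmetricAlgebra.ι A I x) = x := by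
  simp [symEval]

@[simp]
lemma symTensorEval_tmul (s : SymmetricAlgebra A I) (m : M) :
    symTensorEval I M (s ⊗ₜ m) = symEval I s • m := rfl

lemma symTensorEval_smul (s : SymmetricAlgebra A I) (z : SymmetricAlgebra A I ⊗[A] M) :
    symTensorEval I M (s • z) = symEval I s • symTensorEval I M z := by
  induction z with
  | zero => simp
  | add z w hz hw => rw [smul_add, map_add, hz, hw, map_add, smul_add]
  | tmul t m =>
    rw [TensorProduct.smul_tmul', symTensorEval_tmul, symTensorEval_tmul, smul_eq_mul, map_mul,
      mul_smul]

lemma symToRees_eq {n : ℕ} {s : SymmetricAlgebra A I} (hs : s ∈ symDegree I n) :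
    symToRees I s = Polynomial.monomial n (symEval I s) ∧ symEval I s ∈ I ^ n := by
  induction n generalizing s with
  | zero =>
    rw [symDegree, pow_zero] at hs
    obtain ⟨a, rfl⟩ := Submodule.mem_one.1 hs
    simp
  | succ n ih =>
    rw [symDegree, pow_succ] at hs
    refine Submodule.mul_induction_on hs ?_ ?_
    · rintro t ht _ ⟨x, rfl⟩
      obtain ⟨h1, h2⟩ := ih ht
      refine ⟨?_, ?_⟩
      · rw [map_mul, h1, map_mul, symEval_ι]
        simp [symToRees, Polynomial.monomial_mul_monomial]
      · rw [map_mul, symEval_ι, pow_succ]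
        exact Ideal.mul_mem_mul h2 x.2
    · rintro s t ⟨h1, h2⟩ ⟨h3, h4⟩
      exact ⟨by rw [map_add, h1, h3, map_add, map_add], by rw [map_add]; exact Ideal.add_mem _ h2 h4⟩

lemma symTensorDegree_eq_span (n : ℕ) : symTensorDegree I M n =
    Submodule.span A {z | ∃ s ∈ symDegree I n, ∃ m : M, z = s ⊗ₜ m} := by
  rw [symTensorDegree, LinearMap.range_eq_map, ← TensorProduct.span_tmul_eq_top, Submodule.map_span]
  congr 1
  ext z
  constructor
  · rintro ⟨_, ⟨s, m, rfl⟩, rfl⟩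
    exact ⟨s.1, s.2, m, rfl⟩
  · rintro ⟨s, hs, m, rfl⟩
    exact ⟨_, ⟨⟨s, hs⟩, m, rfl⟩, rfl⟩

lemma symTensorToRees_eq {n : ℕ} {z : SymmetricAlgebra A I ⊗[A] M} (hz : z ∈ symTensorDegree I M n) :
    symTensorToRees I M z = PolynomialModule.single A n (symTensorEval I M z) := by
  rw [symTensorDegree_eq_span] at hz
  induction hz using Submodule.span_induction with
  | mem z hz =>
    obtain ⟨s, hs, m, rfl⟩ := hz
    change symToRees I s • PolynomialModule.single A 0 m = _
    rw [(symToRees_eq I hs).1, PolynomialModule.monomial_smul_single, add_zero, symTensorEval_tmul]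
  | zero => simp
  | add z w _ _ hz hw => rw [map_add, hz, hw, map_add, PolynomialModule.single_add]
  | smul a z _ hz => rw [map_smul, hz, map_smul, PolynomialModule.single_smul]

/-- On the degree `n` component γ is evaluation in `M` followed by multiplication by tⁿ, so
membership in its kernel can be tested in `M`. -/
lemma mem_relations_iff {n : ℕ} {z : SymmetricAlgebra A I ⊗[A] M} :
    z ∈ relations I M n ↔ symTensorEval I M z = 0 ∧ z ∈ symTensorDegree I M n := by
  rw [relations, Submodule.mem_inf, LinearMap.mem_ker]
  refine and_congr_left fun hz => ?_
  rw [symTensorToRees_eq I M hz]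
  refine ⟨fun h => ?_, fun h => by rw [h]; simp⟩
  have := congrArg (fun q : PolynomialModule A M => q.coeff n) h
  simpa using this

lemma symTensorEval_mem {n : ℕ} {z : SymmetricAlgebra A I ⊗[A] M} (hz : z ∈ symTensorDegree I M n) :
    symTensorEval I M z ∈ (I ^ n • ⊤ : Submodule A M) := by
  rw [symTensorDegree_eq_span] at hz
  induction hz using Submodule.span_induction with
  | mem z hz =>
    obtain ⟨s, hs, m, rfl⟩ := hz
    exact Submodule.smul_mem_smul (symToRees_eq I hs).2 trivial
  | zero => simp
  | add z w _ _ hz hw => rw [map_add]; exact Submodule.add_mem _ hz hw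
  | smul a z _ hz => rw [map_smul]; exact Submodule.smul_mem _ _ hz

lemma ι_smul_mem_symTensorDegree {n : ℕ} (x : I) {z : SymmetricAlgebra A I ⊗[A] M}
    (hz : z ∈ symTensorDegree I M n) :
    SymmetricAlgebra.ι A I x • z ∈ symTensorDegree I M (n + 1) := by
  rw [symTensorDegree_eq_span] at hz ⊢
  induction hz using Submodule.span_induction with
  | mem z hz =>
    obtain ⟨s, hs, m, rfl⟩ := hz
    refine Submodule.subset_span ⟨SymmetricAlgebra.ι A I x * s, ?_, m, rfl⟩
    rw [symDegree, pow_succ']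
    exact Submodule.mul_mem_mul ⟨x, rfl⟩ hs
  | zero => rw [smul_zero]; exact Submodule.zero_mem _
  | add z w _ _ hz hw => rw [smul_add]; exact Submodule.add_mem _ hz hw
  | smul a z _ hz => rw [smul_comm]; exact Submodule.smul_mem _ _ hz

lemma symTensorDegree_succ_le (n : ℕ) : symTensorDegree I M (n + 1) ≤
    Submodule.span A {z | ∃ x : I, ∃ k ∈ symTensorDegree I M n, z = SymmetricAlgebra.ι A I x • k} := by
  rw [symTensorDegree_eq_span, Submodule.span_le]
  rintro _ ⟨s, hs, m, rfl⟩
  rw [symDegree, pow_succ'] at hs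
  refine Submodule.mul_induction_on hs ?_ ?_
  · rintro _ ⟨x, rfl⟩ t ht
    refine Submodule.subset_span ⟨x, t ⊗ₜ m, ?_, rfl⟩
    rw [symTensorDegree_eq_span]
    exact Submodule.subset_span ⟨t, ht, m, rfl⟩
  · intro s t h h'
    rw [SetLike.mem_coe, TensorProduct.add_tmul]
    exact Submodule.add_mem _ h h'

lemma exists_symTensorEval_eq {n : ℕ} {y : M} (hy : y ∈ (I ^ n • ⊤ : Submodule A M)) :
    ∃ z ∈ symTensorDegree I M n, symTensorEval I M z = y := by
  induction n generalizing y with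
  | zero =>
    refine ⟨1 ⊗ₜ y, ?_, by simp⟩
    rw [symTensorDegree_eq_span]
    exact Submodule.subset_span ⟨1, by rw [symDegree, pow_zero]; exact Submodule.mem_one.2 ⟨1, map_one _⟩, y, rfl⟩
  | succ n ih =>
    rw [pow_succ', mul_smul] at hy
    induction hy using Submodule.smul_induction_on' with
    | smul a ha y hy =>
      obtain ⟨z, hz, rfl⟩ := ih hy
      exact ⟨_, ι_smul_mem_symTensorDegree I M ⟨a, ha⟩ hz, by rw [symTensorEval_smul, symEval_ι]⟩
    | add y hy y' hy' h h' =>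
      obtain ⟨z, hz, rfl⟩ := h
      obtain ⟨z', hz', rfl⟩ := h'
      exact ⟨z + z', Submodule.add_mem _ hz hz', map_add _ _ _⟩

end evaluation

/-! ### Descent from `B` to `A` by linear functionals -/

section contraction

variable {A : Type*} [CommRing A] {B : Type*} [CommRing B] [Algebra A B] (φ : B →ₗ[A] A)

/-- The map `B ⊗ P → P` induced by a linear functional on `B`. -/
def contract (P : Type*) [AddCommGroup P] [Module A P] : B ⊗[A] P →ₗ[A] P :=
  TensorProduct.lift ((LinearMap.lsmul A P) ∘ₗ φ)

variable {P Q : Type*} [AddCommGroup P] [Module A P] [AddCommGroup Q] [Module A Q]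

@[simp]
lemma contract_tmul (b : B) (p : P) : contract φ P (b ⊗ₜ p) = φ b • p := rfl

lemma contract_baseChange (T : P →ₗ[A] Q) (w : B ⊗[A] P) :
    contract φ Q (T.baseChange B w) = T (contract φ P w) := by
  induction w with
  | zero => simp
  | add z w hz hw => rw [map_add, map_add, hz, hw, map_add, map_add]
  | tmul b p => simp

lemma contract_mem {N : Submodule A P} {w : B ⊗[A] P} (hw : w ∈ N.baseChange B) :
    contract φ P w ∈ N := by
  obtain ⟨z, rfl⟩ := N.toBaseChange_surjective' B hw
  clear hw
  induction z with
  | zero => simp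
  | add z w hz hw =>
    rw [map_add, Submodule.coe_add, map_add]
    exact Submodule.add_mem _ hz hw
  | tmul b p =>
    rw [Submodule.coe_toBaseChange_tmul, contract_tmul]
    exact Submodule.smul_mem _ _ p.2

lemma eq_sum_contract {ι : Type*} [Fintype ι] [DecidableEq ι] (b : Module.Basis ι A B)
    (w : B ⊗[A] P) : w = ∑ i, b i ⊗ₜ[A] contract (b.coord i) P w := by
  induction w with
  | zero => simp
  | add z w hz hw =>
    simp only [map_add, TensorProduct.tmul_add, Finset.sum_add_distrib]
    rw [← hz, ← hw]
  | tmul c p =>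
    simp only [contract_tmul, ← TensorProduct.smul_tmul, ← TensorProduct.sum_tmul, Module.Basis.coord_apply]
    rw [b.sum_repr]

/-- The coordinate functionals of a basis recover `w` from its contractions. -/
lemma mem_baseChange_of_forall_contract_mem [Module.Free A B] [Module.Finite A B] {N : Submodule A P}
    {w : B ⊗[A] P} (hw : ∀ φ : B →ₗ[A] A, contract φ P w ∈ N) : w ∈ N.baseChange B := by
  classical
  let b := Module.Free.chooseBasis A B
  rw [eq_sum_contract b w]
  exact Submodule.sum_mem _ fun i _ => Submodule.tmul_mem_baseChange_of_mem _ (hw _)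

lemma baseChange_mem_baseChange {T : P →ₗ[A] Q} {N : Submodule A P} {N' : Submodule A Q}
    (h : ∀ p ∈ N, T p ∈ N') {w : B ⊗[A] P} (hw : w ∈ N.baseChange B) :
    T.baseChange B w ∈ N'.baseChange B := by
  rw [Submodule.baseChange_eq_span] at hw
  induction hw using Submodule.span_induction with
  | mem z hz =>
    obtain ⟨p, hp, rfl⟩ := hz
    exact Submodule.tmul_mem_baseChange_of_mem 1 (h p hp)
  | zero => rw [map_zero]; exact Submodule.zero_mem _
  | add z w _ _ hz hw => rw [map_add]; exact Submodule.add_mem _ hz hw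
  | smul a z _ hz => rw [map_smul]; exact Submodule.smul_mem _ _ hz

end contraction

/-! ### Decomposing relations modulo `N` by means of a reduction -/

section effective

variable {A : Type*} [CommRing A] (I : Ideal A) (M : Type*) [AddCommGroup M] [Module A M]

/-- Multiplication by `x ∈ I = S₁(I)` on `S(I) ⊗ M`. -/
def symMul (x : I) : (SymmetricAlgebra A I ⊗[A] M) →ₗ[A] SymmetricAlgebra A I ⊗[A] M where
  toFun z := SymmetricAlgebra.ι A I x • z
  map_add' z w := smul_add _ z w
  map_smul' a z := smul_comm _ a z

lemma symTensorEval_comp_symMul (x : I) :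
    symTensorEval I M ∘ₗ symMul I M x = (x : A) • symTensorEval I M :=
  LinearMap.ext fun z => by
    rw [LinearMap.comp_apply, LinearMap.smul_apply, ← symEval_ι I x]
    exact symTensorEval_smul I M _ z

lemma symTensorEval_baseChange_symMul {B : Type*} [CommRing B] [Algebra A B] (x : I)
    (w : B ⊗[A] (SymmetricAlgebra A I ⊗[A] M)) :
    (symTensorEval I M).baseChange B ((symMul I M x).baseChange B w) =
      algebraMap A B x • (symTensorEval I M).baseChange B w := by
  rw [← LinearMap.comp_apply, ← LinearMap.baseChange_comp, symTensorEval_comp_symMul,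
    LinearMap.baseChange_smul, LinearMap.smul_apply, algebraMap_smul]

lemma symMul_comp_comm (x y : I) :
    symMul I M x ∘ₗ symMul I M y = symMul I M y ∘ₗ symMul I M x :=
  LinearMap.ext fun z => smul_comm (SymmetricAlgebra.ι A I x) (SymmetricAlgebra.ι A I y) z

/-- Every element of `I B` lifts to an operator on `B ⊗ S(I) ⊗ M`. -/
lemma exists_lift_operator {B : Type*} [CommRing B] [Algebra A B] {f : B}
    (hf : f ∈ I.map (algebraMap A B)) :
    ∃ Φ ∈ Submodule.span B (Set.range fun x : I => (symMul I M x).baseChange B), ∀ w,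
      (symTensorEval I M).baseChange B (Φ w) = f • (symTensorEval I M).baseChange B w := by
  have hf' : f ∈ Submodule.span B (algebraMap A B '' I) := hf
  clear hf
  induction hf' using Submodule.span_induction with
  | mem b hb =>
    obtain ⟨x, hx, rfl⟩ := hb
    exact ⟨_, Submodule.subset_span ⟨⟨x, hx⟩, rfl⟩,
      symTensorEval_baseChange_symMul I M ⟨x, hx⟩⟩
  | zero => exact ⟨0, Submodule.zero_mem _, fun w => by simp⟩
  | add f f' _ _ h h' =>
    obtain ⟨Φ, hΦ, h⟩ := h
    obtain ⟨Φ', hΦ', h'⟩ := h'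
    exact ⟨Φ + Φ', Submodule.add_mem _ hΦ hΦ', fun w => by
      rw [LinearMap.add_apply, map_add, h, h', add_smul]⟩
  | smul b f _ h =>
    obtain ⟨Φ, hΦ, h⟩ := h
    exact ⟨b • Φ, Submodule.smul_mem _ _ hΦ, fun w => by
      rw [LinearMap.smul_apply, map_smul, h, smul_assoc]⟩

section operators

variable {I M} {B : Type*} [CommRing B] [Algebra A B]
  {Φ : (B ⊗[A] (SymmetricAlgebra A I ⊗[A] M)) →ₗ[B] B ⊗[A] (SymmetricAlgebra A I ⊗[A] M)}
  (hΦ : Φ ∈ Submodule.span B (Set.range fun x : I => (symMul I M x).baseChange B))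

include hΦ

lemma operator_mem_baseChange {n : ℕ} {w : B ⊗[A] (SymmetricAlgebra A I ⊗[A] M)}
    (hw : w ∈ (symTensorDegree I M n).baseChange B) :
    Φ w ∈ (symTensorDegree I M (n + 1)).baseChange B := by
  induction hΦ using Submodule.span_induction with
  | mem Φ h =>
    obtain ⟨x, rfl⟩ := h
    exact baseChange_mem_baseChange (fun p hp => ι_smul_mem_symTensorDegree I M x hp) hw
  | zero => exact Submodule.zero_mem _
  | add Φ Φ' _ _ h h' => exact Submodule.add_mem _ h h'
  | smul b Φ _ h => exact Submodule.smul_mem _ _ h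

lemma operator_comm (x : I) (w : B ⊗[A] (SymmetricAlgebra A I ⊗[A] M)) :
    Φ ((symMul I M x).baseChange B w) = (symMul I M x).baseChange B (Φ w) := by
  induction hΦ using Submodule.span_induction with
  | mem Φ h =>
    obtain ⟨y, rfl⟩ := h
    simp only
    rw [← LinearMap.comp_apply, ← LinearMap.comp_apply, ← LinearMap.baseChange_comp,
      ← LinearMap.baseChange_comp, symMul_comp_comm]
  | zero => simp
  | add Φ Φ' _ _ h h' => rw [LinearMap.add_apply, h, h', LinearMap.add_apply, map_add]
  | smul b Φ _ h => rw [LinearMap.smul_apply, h, LinearMap.smul_apply, map_smul]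

end operators

lemma exists_baseChange_symTensorEval_eq {B : Type*} [CommRing B] [Algebra A B] {n : ℕ}
    {h : B ⊗[A] M} (hh : h ∈ (I ^ n • ⊤ : Submodule A M).baseChange B) :
    ∃ z ∈ (symTensorDegree I M n).baseChange B, (symTensorEval I M).baseChange B z = h := by
  rw [Submodule.baseChange_eq_span] at hh
  induction hh using Submodule.span_induction with
  | mem h hh =>
    obtain ⟨y, hy, rfl⟩ := hh
    obtain ⟨z, hz, rfl⟩ := exists_symTensorEval_eq I M hy
    exact ⟨1 ⊗ₜ z, Submodule.tmul_mem_baseChange_of_mem 1 hz, by simp⟩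
  | zero => exact ⟨0, Submodule.zero_mem _, map_zero _⟩
  | add h h' _ _ H H' =>
    obtain ⟨z, hz, rfl⟩ := H
    obtain ⟨z', hz', rfl⟩ := H'
    exact ⟨z + z', Submodule.add_mem _ hz hz', map_add _ _ _⟩
  | smul b h _ H =>
    obtain ⟨z, hz, rfl⟩ := H
    exact ⟨b • z, Submodule.smul_mem _ _ hz, map_smul _ _ _⟩

/-- The span of the products `x k` with `x ∈ I = S₁(I)` and `k` a relation of degree `n` modulo
`N`. -/
def decomposableModulo (N : Submodule A M) (n : ℕ) : Submodule A (SymmetricAlgebra A I ⊗[A] M) :=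
  Submodule.span A {z | ∃ x : I, ∃ k ∈ symTensorDegree I M n,
    symTensorEval I M k ∈ N ∧ z = SymmetricAlgebra.ι A I x • k}

variable {I M} in
lemma contract_symMul_mem {B : Type*} [CommRing B] [Algebra A B] (φ : B →ₗ[A] A) {N : Submodule A M}
    {n : ℕ} (x : I) {w : B ⊗[A] (SymmetricAlgebra A I ⊗[A] M)}
    (hw : w ∈ (symTensorDegree I M n).baseChange B)
    (hN : (symTensorEval I M).baseChange B w ∈ N.baseChange B) :
    contract φ _ ((symMul I M x).baseChange B w) ∈ decomposableModulo I M N n := by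
  rw [contract_baseChange]
  refine Submodule.subset_span ⟨x, _, contract_mem φ hw, ?_, rfl⟩
  rw [← contract_baseChange]
  exact contract_mem φ hN

/-- If `f ∈ I B` satisfies `I ^ (m + 1) M ⊆ f I ^ m M + N` after the extension `A → B` and is regular
on the image of `I ^ (m + 1) M` in `M / N`, then the relations of degree `m + 2` modulo `N` are
decomposable. -/
theorem mem_span_of_symTensorEval_mem {B : Type*} [CommRing B] [Algebra A B] (φ : B →ₗ[A] A)
    (hφ : φ 1 = 1) {f : B} (hf : f ∈ I.map (algebraMap A B)) (N : Submodule A M) {m : ℕ}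
    (h₁ : ∀ y ∈ (I ^ (m + 1) • ⊤ : Submodule A M),
      ∃ h ∈ (I ^ m • ⊤ : Submodule A M).baseChange B, (1 : B) ⊗ₜ[A] y - f • h ∈ N.baseChange B)
    (h₂ : ∀ w ∈ (I ^ (m + 1) • ⊤ : Submodule A M).baseChange B, f • w ∈ N.baseChange B →
      w ∈ N.baseChange B)
    {F : SymmetricAlgebra A I ⊗[A] M} (hF : F ∈ symTensorDegree I M (m + 2))
    (hFN : symTensorEval I M F ∈ N) :
    F ∈ decomposableModulo I M N (m + 1) := by
  obtain ⟨Φ, hΦ, hΦf⟩ := exists_lift_operator I M hf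
  let R : Submodule A (B ⊗[A] (SymmetricAlgebra A I ⊗[A] M)) :=
    Submodule.span A {z | ∃ x : I, ∃ r ∈ (symTensorDegree I M (m + 1)).baseChange B,
      (symTensorEval I M).baseChange B r ∈ N.baseChange B ∧ z = (symMul I M x).baseChange B r}
  -- Write F = ∑ xᵢGᵢ and let zᵢ lift hᵢ, where f hᵢ is the value of Gᵢ modulo N. Then Gᵢ − Φzᵢ is a
  -- relation modulo N, and what remains is Φw with w = ∑ xᵢzᵢ.
  obtain ⟨r, hr, w, hw, hrw⟩ : ∃ r ∈ R, ∃ w ∈ (symTensorDegree I M (m + 1)).baseChange B,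
      (1 : B) ⊗ₜ[A] F = r + Φ w := by
    have hF' := symTensorDegree_succ_le I M (m + 1) hF
    clear hF hFN
    induction hF' using Submodule.span_induction with
    | mem F hF =>
      obtain ⟨x, G, hG, rfl⟩ := hF
      obtain ⟨h, hh, hN⟩ := h₁ _ (symTensorEval_mem I M hG)
      obtain ⟨z, hz, rfl⟩ := exists_baseChange_symTensorEval_eq I M hh
      refine ⟨(symMul I M x).baseChange B ((1 : B) ⊗ₜ[A] G - Φ z), Submodule.subset_span ⟨x, _,
        Submodule.sub_mem _ (Submodule.tmul_mem_baseChange_of_mem 1 hG)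
          (operator_mem_baseChange hΦ hz), ?_, rfl⟩,
        (symMul I M x).baseChange B z,
        baseChange_mem_baseChange (fun p hp => ι_smul_mem_symTensorDegree I M x hp) hz, ?_⟩
      · rwa [map_sub, hΦf, LinearMap.baseChange_tmul]
      · rw [operator_comm hΦ, map_sub, sub_add_cancel, LinearMap.baseChange_tmul]
        rfl
    | zero => exact ⟨0, Submodule.zero_mem _, 0, Submodule.zero_mem _, by simp⟩
    | add F F' _ _ h h' =>
      obtain ⟨r, hr, w, hw, h⟩ := h
      obtain ⟨r', hr', w', hw', h'⟩ := h'
      refine ⟨r + r', Submodule.add_mem _ hr hr', w + w', Submodule.add_mem _ hw hw', ?_⟩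
      rw [TensorProduct.tmul_add, h, h', map_add]
      abel
    | smul a F _ h =>
      obtain ⟨r, hr, w, hw, h⟩ := h
      refine ⟨a • r, Submodule.smul_mem _ _ hr, a • w,
        Submodule.smul_of_tower_mem _ a hw, ?_⟩
      rw [TensorProduct.tmul_smul, h, smul_add, LinearMap.map_smul_of_tower]
  have hrN : (symTensorEval I M).baseChange B r ∈ N.baseChange B ∧
      contract φ _ r ∈ decomposableModulo I M N (m + 1) := by
    clear hrw
    induction hr using Submodule.span_induction with
    | mem r hr =>
      obtain ⟨x, r, hr, hN, rfl⟩ := hr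
      refine ⟨?_, contract_symMul_mem φ x hr hN⟩
      rw [symTensorEval_baseChange_symMul]
      exact Submodule.smul_mem _ _ hN
    | zero => simp
    | add r r' _ _ h h' =>
      rw [map_add, map_add]
      exact ⟨Submodule.add_mem _ h.1 h'.1, Submodule.add_mem _ h.2 h'.2⟩
    | smul a r _ h =>
      rw [LinearMap.map_smul_of_tower, LinearMap.map_smul_of_tower]
      exact ⟨Submodule.smul_of_tower_mem _ a h.1, Submodule.smul_mem _ _ h.2⟩
  -- The value of Φw is f times that of w, and lies in N since the values of F and r do. Regularity
  -- removes f.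
  have hwN : (symTensorEval I M).baseChange B w ∈ N.baseChange B := by
    refine h₂ _ (baseChange_mem_baseChange (fun p hp => symTensorEval_mem I M hp) hw) ?_
    rw [← hΦf, ← add_sub_cancel_left r (Φ w), ← hrw, map_sub, LinearMap.baseChange_tmul]
    exact Submodule.sub_mem _ (Submodule.tmul_mem_baseChange_of_mem 1 hFN) hrN.1
  -- Φ is a B-combination of multiplications by elements of `I`, so Φw is decomposable as well. The
  -- scalars from B are moved into w before contracting.
  have hΦw : ∀ w ∈ (symTensorDegree I M (m + 1)).baseChange B,
      (symTensorEval I M).baseChange B w ∈ N.baseChange B →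
      contract φ _ (Φ w) ∈ decomposableModulo I M N (m + 1) := by
    clear hΦf hrw
    induction hΦ using Submodule.span_induction with
    | mem Φ h =>
      obtain ⟨x, rfl⟩ := h
      exact fun w hw hN => contract_symMul_mem φ x hw hN
    | zero => simp
    | add Φ Φ' _ _ h h' =>
      intro w hw hN
      rw [LinearMap.add_apply, map_add]
      exact Submodule.add_mem _ (h w hw hN) (h' w hw hN)
    | smul b Φ _ h =>
      intro w hw hN
      rw [LinearMap.smul_apply, ← map_smul]
      exact h _ (Submodule.smul_mem _ b hw) (by rw [map_smul]; exact Submodule.smul_mem _ b hN)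
  have hcF : contract φ _ ((1 : B) ⊗ₜ[A] F) = F := by rw [contract_tmul, hφ, one_smul]
  rw [← hcF, hrw, map_add]
  exact Submodule.add_mem _ hrN.2 (hΦw w hw hwN)

end effective

/-! ### From relations modulo `N` to true relations -/

section relationType

variable {A : Type*} [CommRing A] {I : Ideal A} {M : Type*} [AddCommGroup M] [Module A M]

lemma smul_one_tmul_mem_baseChange {B : Type*} [CommRing B] [Algebra A B] {K : Ideal A} {b : B}
    (hb : b ∈ K.map (algebraMap A B)) (x : M) :
    b • ((1 : B) ⊗ₜ[A] x) ∈ (K • ⊤ : Submodule A M).baseChange B := by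
  have hb' : b ∈ Submodule.span B (algebraMap A B '' K) := hb
  clear hb
  induction hb' using Submodule.span_induction with
  | mem b hb =>
    obtain ⟨a, ha, rfl⟩ := hb
    rw [algebraMap_smul, ← TensorProduct.tmul_smul]
    exact Submodule.tmul_mem_baseChange_of_mem _ (Submodule.smul_mem_smul ha trivial)
  | zero => rw [zero_smul]; exact Submodule.zero_mem _
  | add b c _ _ h h' => rw [add_smul]; exact Submodule.add_mem _ h h'
  | smul b c _ h => rw [smul_assoc]; exact Submodule.smul_mem _ _ h

lemma smul_mem_H0 {𝔞 : Ideal A} {a : A} (ha : a ∈ H0 𝔞 A) (x : M) : a • x ∈ H0 𝔞 M := by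
  obtain ⟨k, hk⟩ := ha
  exact ⟨k, fun c hc => by rw [← smul_assoc, hk c hc, zero_smul]⟩

lemma exists_smul_eq_zero_of_mem_H0 {𝔞 p : Ideal A} (hp : p.IsPrime) (h : ¬ 𝔞 ≤ p) {x : M}
    (hx : x ∈ H0 𝔞 M) : ∃ s ∉ p, s • x = 0 := by
  obtain ⟨k, hk⟩ := hx
  obtain ⟨u, hu, hup⟩ := SetLike.not_le_iff_exists.1 h
  exact ⟨u ^ k, fun hu' => hup (hp.mem_of_pow_mem k hu'), hk _ (Ideal.pow_mem_pow hu k)⟩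

lemma rt_le {r : ℕ} (hr : 1 ≤ r)
    (h : ∀ n, r ≤ n → relations I M (n + 1) ≤ decomposableRelations I M n) : rt I M ≤ r := by
  refine iInf₂_le r ⟨hr, fun n hn => ?_⟩
  exact LinearMap.le_ker_iff_map.1 (by rw [Submodule.ker_mkQ]; exact h n hn)

/-- The factors of degree `n` in a decomposition modulo `N` have value in `N ⊓ I ^ n • ⊤`, so they
are genuine relations once this vanishes. -/
lemma relations_le_of_inf_eq_bot {N : Submodule A M} {n : ℕ}
    (hN : ∀ F ∈ symTensorDegree I M (n + 1), symTensorEval I M F ∈ N →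
      F ∈ decomposableModulo I M N n)
    (hbot : N ⊓ I ^ n • ⊤ = ⊥) : relations I M (n + 1) ≤ decomposableRelations I M n := by
  intro F hF
  rw [mem_relations_iff] at hF
  have := hN F hF.2 (by rw [hF.1]; exact N.zero_mem)
  refine Submodule.span_mono ?_ this
  rintro _ ⟨x, k, hk, hkN, rfl⟩
  refine ⟨x, k, (mem_relations_iff I M).2 ⟨?_, hk⟩, rfl⟩
  rw [← Submodule.mem_bot A, ← hbot]
  exact ⟨hkN, symTensorEval_mem I M hk⟩

/-- Here f = 1 and B = A serve. The unit ideal is set apart because Nakayama needs `I` proper. -/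
lemma relations_top_le (n : ℕ) :
    relations (⊤ : Ideal A) M (n + 2) ≤ decomposableRelations (⊤ : Ideal A) M (n + 1) := by
  refine relations_le_of_inf_eq_bot (N := ⊥) (fun F hF hFN => ?_) (bot_inf_eq _)
  refine mem_span_of_symTensorEval_mem ⊤ M (B := A) LinearMap.id rfl (f := 1) (by simp) ⊥
    (fun y _ => ⟨1 ⊗ₜ y, ?_, ?_⟩) (fun w _ hw => ?_) hF hFN
  · rw [Ideal.top_pow, Submodule.top_smul, Submodule.baseChange_top]
    trivial
  · simp
  · rwa [one_smul] at hw

/-- An Artin–Rees statement, read off by lifting an element to S(I) ⊗ M and evaluating a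
decomposition of the lift. -/
lemma inf_pow_smul_succ_le {N : Submodule A M} {n : ℕ}
    (hN : ∀ F ∈ symTensorDegree I M (n + 1), symTensorEval I M F ∈ N →
      F ∈ decomposableModulo I M N n) :
    N ⊓ I ^ (n + 1) • ⊤ ≤ I • (N ⊓ I ^ n • ⊤) := by
  rintro y ⟨hy, hyI⟩
  obtain ⟨F, hF, rfl⟩ := exists_symTensorEval_eq I M hyI
  have hmem := hN F hF hy
  clear hF hy hyI
  rw [decomposableModulo] at hmem
  induction hmem using Submodule.span_induction with
  | mem F h =>
    obtain ⟨x, k, hk, hkN, rfl⟩ := h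
    rw [symTensorEval_smul, symEval_ι]
    exact Submodule.smul_mem_smul x.2 ⟨hkN, symTensorEval_mem I M hk⟩
  | zero => rw [map_zero]; exact Submodule.zero_mem _
  | add F G _ _ h h' => rw [map_add]; exact Submodule.add_mem _ h h'
  | smul a F _ h => rw [map_smul]; exact Submodule.smul_mem _ _ h

lemma length_add_one_le_of_lt {N N' : Submodule A M} (h : N < N') :
    Module.length A N + 1 ≤ Module.length A N' := by
  rw [Module.length_eq_add_of_exact (Submodule.inclusion h.le)
    (LinearMap.range (Submodule.inclusion h.le)).mkQ (Submodule.inclusion_injective h.le)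
    (Submodule.mkQ_surjective _) (LinearMap.exact_map_mkQ_range _)]
  refine add_le_add_right ?_ _
  rw [Order.one_le_iff_ne_zero, ne_eq, Module.length_eq_zero_iff,
    Submodule.Quotient.subsingleton_iff, Submodule.range_inclusion]
  intro htop
  obtain ⟨x, hx, hxN⟩ := SetLike.exists_of_lt h
  exact hxN (htop ▸ Submodule.mem_top : (⟨x, hx⟩ : N') ∈ Submodule.comap N'.subtype N)

variable [IsLocalRing A] [IsNoetherianRing A]

/-- From exponent `b` on, each intersection lies in `I` times its predecessor. By Nakayama it is
strictly smaller unless zero, so at most length(N) drops occur. -/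
lemma inf_pow_smul_eq_bot [Module.Finite A M] (hI : I ≠ ⊤) {N : Submodule A M} {b l : ℕ}
    (hN : ∀ n, b ≤ n → ∀ F ∈ symTensorDegree I M (n + 1), symTensorEval I M F ∈ N →
      F ∈ decomposableModulo I M N n) (hl : Module.length A N ≤ l) {n : ℕ} (hn : b + l ≤ n) :
    N ⊓ I ^ n • ⊤ = ⊥ := by
  have key (i : ℕ) : N ⊓ I ^ (b + i) • ⊤ = ⊥ ∨
      Module.length A (N ⊓ I ^ (b + i) • ⊤ : Submodule A M) + i ≤ Module.length A N := by
    induction i with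
    | zero =>
      right
      rw [Nat.cast_zero, add_zero]
      exact Module.length_le_of_injective _ (Submodule.inclusion_injective inf_le_left)
    | succ i ih =>
      have hle := inf_pow_smul_succ_le (hN (b + i) (Nat.le_add_right b i))
      rcases ih with ih | ih
      · left
        rw [ih, Submodule.smul_bot] at hle
        exact le_bot_iff.1 hle
      · by_cases hbot : N ⊓ I ^ (b + i) • ⊤ = ⊥
        · left
          rw [hbot, Submodule.smul_bot] at hle
          exact le_bot_iff.1 hle
        right
        have hlt : N ⊓ I ^ (b + (i + 1)) • ⊤ < N ⊓ I ^ (b + i) • ⊤ := by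
          refine lt_of_le_of_ne (hle.trans Submodule.smul_le_right) fun heq => hbot ?_
          refine Submodule.eq_bot_of_le_smul_of_le_jacobson_bot I _ (IsNoetherian.noetherian _)
            (heq.ge.trans hle) ?_
          rw [IsLocalRing.jacobson_eq_maximalIdeal _ bot_ne_top]
          exact le_maximalIdeal hI
        calc _ = (Module.length A (N ⊓ I ^ (b + (i + 1)) • ⊤ : Submodule A M) + 1) + i := by
              push_cast
              ring
          _ ≤ _ := (add_le_add_left (length_add_one_le_of_lt hlt) _).trans ih
  have hbl : N ⊓ I ^ (b + l) • ⊤ = ⊥ := by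
    refine (key l).elim id fun h => ?_
    have h0 : Module.length A (N ⊓ I ^ (b + l) • ⊤ : Submodule A M) = 0 := by
      have := h.trans hl
      revert this
      generalize Module.length A (N ⊓ I ^ (b + l) • ⊤ : Submodule A M) = c
      intro hc
      have : c ≠ ⊤ := by
        rintro rfl
        simp at hc
      lift c to ℕ using this
      norm_cast at hc ⊢
      omega
    rw [Module.length_eq_zero_iff] at h0
    exact Submodule.subsingleton_iff_eq_bot.1 h0
  rw [eq_bot_iff, ← hbl]
  exact inf_le_inf_left _ (Submodule.smul_mono_left (Ideal.pow_le_pow_right hn))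

/-- Supplies the two inputs of `mem_span_of_symTensorEval_mem` for N = H⁰_𝔪(M): the reduction modulo
N, since JM ⊆ N, and the regularity of f modulo N. -/
lemma mem_decomposableModulo_of_hasReduction {J : Ideal A} {m : ℕ} (hred : HasReduction I J m)
    (hJ : J ≤ H0 (maximalIdeal A) A)
    (hp : ∀ p : Ideal A, p.IsPrime → p ≠ maximalIdeal A →
        ¬ I ≤ p ∨ ∀ a ∈ I ^ (m + 1), ∃ s ∉ p, s * a ∈ J)
    {F : SymmetricAlgebra A I ⊗[A] M} (hF : F ∈ symTensorDegree I M (m + 2))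
    (hFN : symTensorEval I M F ∈ H0 (maximalIdeal A) M) :
    F ∈ decomposableModulo I M (H0 (maximalIdeal A) M) (m + 1) := by
  obtain ⟨g, hg, hd, f, hf, hle⟩ := hred
  have : Module.Finite A (AdjoinRoot g) := hg.finite_adjoinRoot
  have : Module.Free A (AdjoinRoot g) := hg.free_adjoinRoot
  have hJM : (J • ⊤ : Submodule A M) ≤ H0 (maximalIdeal A) M :=
    Submodule.smul_le.2 fun a ha x _ => smul_mem_H0 (hJ ha) x
  have hdec (a : A) (ha : a ∈ I ^ (m + 1)) : ∃ b ∈ (I ^ m).map (algebraMap A (AdjoinRoot g)),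
      ∃ j ∈ J.map (algebraMap A (AdjoinRoot g)), f * b + j = algebraMap A (AdjoinRoot g) a := by
    obtain ⟨c, hc, j, hj, hcj⟩ := Submodule.mem_sup.1 (hle (Ideal.mem_map_of_mem _ ha))
    obtain ⟨b, hb, rfl⟩ := Ideal.mem_span_singleton_mul.1 hc
    exact ⟨b, hb, j, hj, hcj⟩
  have hJw {j : AdjoinRoot g} (hj : j ∈ J.map (algebraMap A (AdjoinRoot g)))
      (w : AdjoinRoot g ⊗[A] M) :
      j • w ∈ (H0 (maximalIdeal A) M).baseChange (AdjoinRoot g) := by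
    induction w with
    | zero => rw [smul_zero]; exact Submodule.zero_mem _
    | add w w' h h' => rw [smul_add]; exact Submodule.add_mem _ h h'
    | tmul c x =>
      rw [← mul_one c, ← smul_eq_mul, ← TensorProduct.smul_tmul', smul_comm]
      exact Submodule.smul_mem _ _
        (Submodule.baseChange_mono _ hJM (smul_one_tmul_mem_baseChange hj x))
  -- The coefficient of 1 in the power basis, which exists because deg g ≠ 0.
  obtain ⟨φ, hφ⟩ : ∃ φ : AdjoinRoot g →ₗ[A] A, φ 1 = 1 := by
    let pb := AdjoinRoot.powerBasis' hg
    let i : Fin pb.dim := ⟨0, Nat.pos_of_ne_zero hd⟩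
    have hi : pb.basis i = 1 := by rw [pb.basis_eq_pow, pow_zero]
    exact ⟨pb.basis.coord i, by rw [← hi, Module.Basis.coord_apply, Module.Basis.repr_self,
      Finsupp.single_eq_same]⟩
  refine mem_span_of_symTensorEval_mem I M φ hφ hf _ (fun y hy => ?_) (fun w hw hfw => ?_) hF hFN
  · induction hy using Submodule.smul_induction_on' with
    | smul a ha x _ =>
      obtain ⟨b, hb, j, hj, hbj⟩ := hdec a ha
      refine ⟨b • ((1 : AdjoinRoot g) ⊗ₜ[A] x), smul_one_tmul_mem_baseChange hb x, ?_⟩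
      rw [TensorProduct.tmul_smul, ← algebraMap_smul (AdjoinRoot g) a, ← hbj, add_smul, mul_smul,
        add_sub_cancel_left]
      exact hJw hj _
    | add y _ y' _ h h' =>
      obtain ⟨z, hz, h⟩ := h
      obtain ⟨z', hz', h'⟩ := h'
      refine ⟨z + z', Submodule.add_mem _ hz hz', ?_⟩
      rw [TensorProduct.tmul_add, smul_add, add_sub_add_comm]
      exact Submodule.add_mem _ h h'
  -- Regularity is checked at each prime p ≠ 𝔪, where N vanishes. If I ⊄ p, some a ∈ I^(m+1) outside
  -- p has the form fb + j, so aw = b(fw) + jw lies in N. Otherwise a multiplier outside p sends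
  -- each contraction of w into JM ⊆ N.
  · refine mem_baseChange_of_forall_contract_mem fun ψ => mem_H0_of_forall_prime fun p hpp hpm => ?_
    have hmp : ¬ maximalIdeal A ≤ p := fun h =>
      hpm (le_antisymm (le_maximalIdeal hpp.ne_top) h)
    obtain ⟨s, hs, hsz⟩ : ∃ s ∉ p, s • contract ψ M w ∈ H0 (maximalIdeal A) M := by
      rcases hp p hpp hpm with h | h
      · obtain ⟨a, ha, hap⟩ : ∃ a ∈ I ^ (m + 1), a ∉ p := by
          refine SetLike.not_le_iff_exists.1 fun hle => h (hpp.le_of_pow_le hle)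
        refine ⟨a, hap, ?_⟩
        obtain ⟨b, hb, j, hj, hbj⟩ := hdec a ha
        rw [← map_smul]
        refine contract_mem ψ ?_
        rw [← algebraMap_smul (AdjoinRoot g) a, ← hbj, add_smul, mul_comm f b, mul_smul]
        exact Submodule.add_mem _ (Submodule.smul_mem _ _ hfw) (hJw hj _)
      · have hz := contract_mem ψ hw
        generalize contract ψ M w = z at hz ⊢
        induction hz using Submodule.smul_induction_on' with
        | smul a ha x _ =>
          obtain ⟨s, hs, hsa⟩ := h a ha
          exact ⟨s, hs, by rw [smul_smul]; exact smul_mem_H0 (hJ hsa) x⟩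
        | add y _ y' _ h h' =>
          obtain ⟨s, hs, h⟩ := h
          obtain ⟨s', hs', h'⟩ := h'
          refine ⟨s * s', fun hss => (hpp.mem_or_mem hss).elim hs hs', ?_⟩
          rw [smul_add, mul_smul, mul_smul, smul_comm s s' y]
          exact Submodule.add_mem _ (Submodule.smul_mem _ _ h) (Submodule.smul_mem _ _ h')
    obtain ⟨t, ht, htz⟩ := exists_smul_eq_zero_of_mem_H0 hpp hmp hsz
    exact ⟨t * s, fun hts => (hpp.mem_or_mem hts).elim ht hs, by rw [mul_smul, htz]⟩

end relationType

/-! ### The bounds on the global relation type -/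

section bound

variable {A : Type*} [CommRing A] [IsLocalRing A] [IsNoetherianRing A]

/-- Stated for a surjection A → R so that R = A/J and R = A are both covered. -/
theorem grt_le {R : Type*} [CommRing R] [IsLocalRing R] [IsNoetherianRing R] [Ring.KrullDimLE 1 R]
    [Algebra A R] (hsurj : Function.Surjective (algebraMap A R))
    (hH : H0 (maximalIdeal R) R = ⊥) (hker : RingHom.ker (algebraMap A R) ≤ H0 (maximalIdeal A) A)
    (M : Type*) [AddCommGroup M] [Module A M] [Module.Finite A M] :
    grt A M ≤ brt R (maximalIdeal R) + Module.length A (H0 (maximalIdeal A) M) := by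
  obtain ⟨b, hb⟩ := ENat.ne_top_iff_exists.1 (brt_ne_top (R := R) (maximalIdeal R))
  rcases eq_or_ne (Module.length A (H0 (maximalIdeal A) M)) ⊤ with hl | hl
  · rw [hl, add_top]
    exact le_top
  obtain ⟨l, hl⟩ := ENat.ne_top_iff_exists.1 hl
  have hb1 : 1 ≤ b := (nilIndex_spec R).1.trans (nilIndex_le_of_brt_le hb.ge)
  rw [← hb, ← hl]
  refine iSup_le fun I => ?_
  rw [← Nat.cast_add]
  refine rt_le (hb1.trans (Nat.le_add_right b l)) fun n hn => ?_
  by_cases hI : I = ⊤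
  · obtain ⟨n, rfl⟩ := Nat.exists_eq_add_of_le' (hb1.trans ((Nat.le_add_right b l).trans hn))
    rw [hI]
    exact relations_top_le n
  have hN (n : ℕ) (hn : b ≤ n) (F) (hF : F ∈ symTensorDegree I M (n + 1))
      (hFN : symTensorEval I M F ∈ H0 (maximalIdeal A) M) :
      F ∈ decomposableModulo I M (H0 (maximalIdeal A) M) n := by
    -- A reduction indexed by `n` concerns `I ^ (n + 1)` and treats relations of degree n + 2,
    -- whence the shift by one, possible since b ≥ 1.
    obtain ⟨n, rfl⟩ := Nat.exists_eq_add_of_le' (hb1.trans hn)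
    obtain ⟨hred, hp⟩ := hasReduction_of_brt_le hsurj hH I (n := n)
      (hb.ge.trans (by exact_mod_cast hn))
    exact mem_decomposableModulo_of_hasReduction hred hker hp hF hFN
  exact relations_le_of_inf_eq_bot (hN n ((Nat.le_add_right b l).trans hn))
    (inf_pow_smul_eq_bot hI hN hl.ge hn)

omit [IsNoetherianRing A] in
lemma H0_eq_bot_of_isCohenMacaulay {M : Type*} [AddCommGroup M] [Module A M]
    (hM : IsCohenMacaulay A M) (hdim : Module.supportDim A M = 1) :
    H0 (maximalIdeal A) M = ⊥ := by
  obtain ⟨rs, hrs, hreg, hlen⟩ := hM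
  rw [hdim] at hlen
  obtain ⟨r, rfl⟩ := List.length_eq_one_iff.1 (by exact_mod_cast hlen : rs.length = 1)
  have hr := (RingTheory.Sequence.isWeaklyRegular_singleton_iff M r).1 hreg.toIsWeaklyRegular
  rw [eq_bot_iff]
  rintro x ⟨k, hk⟩
  exact (hr.pow k) ((hk _ (Ideal.pow_mem_pow (hrs r (List.mem_singleton_self r)) k)).trans
    (smul_zero _).symm)

omit [IsNoetherianRing A] in
-- If 1 were in H⁰, then 𝔪 would be nilpotent and the dimension zero.
lemma H0_maximalIdeal_ne_top (hA : ringKrullDim A = 1) : H0 (maximalIdeal A) A ≠ ⊤ := by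
  intro htop
  obtain ⟨k, hk⟩ : (1 : A) ∈ H0 (maximalIdeal A) A := htop ▸ Submodule.mem_top
  have h0 : Ring.KrullDimLE 0 A := Ring.krullDimLE_zero_iff.2 fun p hp => by
    have : maximalIdeal A ≤ p := hp.le_of_pow_le (n := k) fun a ha => by
      have := hk a ha
      rw [smul_eq_mul, mul_one] at this
      rw [this]
      exact p.zero_mem
    rw [← (maximalIdeal.isMaximal A).eq_of_le hp.ne_top this]
    exact maximalIdeal.isMaximal A
  rw [Ring.krullDimLE_iff, hA] at h0
  norm_cast at h0

/-- An element multiplied into H⁰ by a power of 𝔪 is annihilated outside every prime p ≠ 𝔪, so it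
already lies in H⁰. -/
lemma H0_quotient_H0_eq_bot [IsLocalRing (A ⧸ (H0 (maximalIdeal A) A : Ideal A))] :
    H0 (maximalIdeal (A ⧸ (H0 (maximalIdeal A) A : Ideal A)))
      (A ⧸ (H0 (maximalIdeal A) A : Ideal A)) = ⊥ := by
  rw [eq_bot_iff]
  rintro z ⟨k, hk⟩
  obtain ⟨z, rfl⟩ := Ideal.Quotient.mk_surjective z
  rw [Submodule.mem_bot, Ideal.Quotient.eq_zero_iff_mem]
  refine mem_H0_of_forall_prime fun p hp hpm => ?_
  have hmp : ¬ maximalIdeal A ≤ p := fun h => hpm (le_antisymm (le_maximalIdeal hp.ne_top) h)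
  obtain ⟨u, hu, hup⟩ := SetLike.not_le_iff_exists.1 hmp
  have h0 := hk (Ideal.Quotient.mk _ (u ^ k)) (by
    rw [← map_maximalIdeal_of_surjective _ Ideal.Quotient.mk_surjective, map_pow]
    exact Ideal.pow_mem_pow (Ideal.mem_map_of_mem _ hu) k)
  rw [smul_eq_mul, ← map_mul, Ideal.Quotient.eq_zero_iff_mem] at h0
  obtain ⟨s, hs, hsz⟩ := exists_smul_eq_zero_of_mem_H0 hp hmp h0
  exact ⟨s * u ^ k, fun h => (hp.mem_or_mem h).elim hs fun h => hup (hp.mem_of_pow_mem k h), by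
    rwa [smul_eq_mul, mul_assoc]⟩

theorem grt_le_brt_quotient_add_length (hA : ringKrullDim A = 1) (M : Type*) [AddCommGroup M]
    [Module A M] [Module.Finite A M] :
    grt A M ≤ brt (A ⧸ (H0 (maximalIdeal A) A : Ideal A))
        ((maximalIdeal A).map (Ideal.Quotient.mk (H0 (maximalIdeal A) A))) +
      Module.length A (H0 (maximalIdeal A) M) := by
  have : Nontrivial (A ⧸ (H0 (maximalIdeal A) A : Ideal A)) :=
    Ideal.Quotient.nontrivial_iff.2 (H0_maximalIdeal_ne_top hA)
  have : IsLocalRing (A ⧸ (H0 (maximalIdeal A) A : Ideal A)) :=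
    IsLocalRing.of_surjective' (Ideal.Quotient.mk _) Ideal.Quotient.mk_surjective
  have : Ring.KrullDimLE 1 (A ⧸ (H0 (maximalIdeal A) A : Ideal A)) :=
    Ring.krullDimLE_iff.2 ((ringKrullDim_quotient_le _).trans hA.le)
  rw [map_maximalIdeal_of_surjective _ Ideal.Quotient.mk_surjective]
  exact grt_le Ideal.Quotient.mk_surjective H0_quotient_H0_eq_bot
    (by rw [Ideal.Quotient.algebraMap_eq, Ideal.mk_ker]) M

end bound

end RelationType

end

theorem mainTheorem6 {A : Type*} [CommRing A] [IsLocalRing A] [IsNoetherianRing A]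
    (hA : ringKrullDim A = 1)
    (J : Ideal A) (hJ : J = RelationType.H0 (IsLocalRing.maximalIdeal A) A) :
    RelationType.grt A A ≤
        RelationType.brt (A ⧸ J) ((IsLocalRing.maximalIdeal A).map (Ideal.Quotient.mk J)) +
          Module.length A J ∧
      ∀ (M : Type*) [AddCommGroup M] [Module A M] [Module.Finite A M],
        Module.supportDim A M = 1 →
        (∀ N : Submodule A M, N = RelationType.H0 (IsLocalRing.maximalIdeal A) M →
          RelationType.grt A M ≤
            RelationType.brt (A ⧸ J) ((IsLocalRing.maximalIdeal A).map (Ideal.Quotient.mk J)) +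
              Module.length A N) ∧
        (RelationType.IsCohenMacaulay A A → RelationType.IsCohenMacaulay A M →
          RelationType.grt A M ≤ RelationType.brt A (IsLocalRing.maximalIdeal A)) := by
  subst hJ
  refine ⟨RelationType.grt_le_brt_quotient_add_length hA A, fun M _ _ _ hM => ⟨?_, fun hAcm hMcm => ?_⟩⟩
  · rintro _ rfl
    exact RelationType.grt_le_brt_quotient_add_length hA M
  · have : Ring.KrullDimLE 1 A := RelationType.krullDimLE_one_of_ringKrullDim_eq hA
    have h := RelationType.grt_le (R := A) Function.surjective_id
      (RelationType.H0_eq_bot_of_isCohenMacaulay hAcm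
        (Module.supportDim_self_eq_ringKrullDim A |>.trans hA))
      (fun a ha => by rw [show a = 0 from ha]; exact Submodule.zero_mem _) M
    rwa [RelationType.H0_eq_bot_of_isCohenMacaulay hMcm hM,
      Module.length_eq_zero_iff.2 inferInstance, add_zero] at h
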